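/- Let $\Bbbk$ be a field and let $A\neq 0$ and $Y$ be regular multiplier Hopf algebras over $\Bbbk$ (nondegenerate associative algebras, possibly without unit, with coassociative algebra homomorphisms $\Delta_A:A\to M(A\otimes A)$, $\Delta_Y:Y\to M(Y\otimes Y)$ such that $\Delta(a)(1\otimes b)$, $(a\otimes 1)\Delta(b)$, $\Delta(a)(b\otimes 1)$, $(1\otimes a)\Delta(b)$ lie in the tensor square and the four corresponding canonical maps are bijective), with counits $\varepsilon_A$, $\varepsilon_Y$; $M(\cdot)$ denotes the multiplier algebra, $\imath$ identity maps, $\tau$ flips, and nondegenerate homomorphisms are extended canonically to multiplier algebras. Let $\rho:Y\to M(A\otimes Y)$ be a linear map. $Y$ is a *symmetric partial $A$-comodule coalgebra via $\rho$* if $T(y\otimes a)=\rho(y)(a\otimes 1)$ and $\overline T(a\otimes y)=(a\otimes 1)\rho(y)$ lie in $A\otimes Y$ for all $a\in A$, $y\in Y$ (so that $T:Y\otimes A\to A\otimes Y$ and $\overline T:A\otimes Y\to A\otimes Y$ are linear maps) and, for all $y,y'\in Y$, $a\in A$: (i) $(\varepsilon_A\otimes\imath_Y)\rho(y)=y$;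 (ii) $((\imath_Y\otimes T)(\Delta_Y(y)\otimes a))(1\otimes1\otimes y')$ and $(1\otimes1\otimes y')((\imath_Y\otimes T)(\Delta_Y(y)\otimes a))$ lie in $Y\otimes A\otimes Y$; (iii) $(\imath_A\otimes\Delta_Y)T=(T\otimes\imath_Y)(\imath_Y\otimes T)(\Delta_Y\otimes\imath_A)$; (iv) $(\imath_A\otimes T)(T\otimes\imath_A)(\imath_Y\otimes\Delta_A)=((\imath_A\otimes\varepsilon_Y)T\otimes\imath_A\otimes\imath_Y)(\imath_Y\otimes(\Delta_A\otimes\imath_Y)T)(\Delta_Y\otimes\imath_A)$; (v) $((\overline T\otimes\imath_Y)(a\otimes\Delta_Y(y)))(1\otimes y'\otimes 1)\in A\otimes Y\otimes Y$; (vi) $(\imath_A\otimes\overline T)(\imath_A\otimes\tau_{Y\otimes A})(\overline T\otimes\imath_A)(\imath_A\otimes\tau_{A\otimes Y})(\Delta_A\otimes\imath_Y)=((\imath_A\otimes\varepsilon_Y)\overline T\otimes\imath_A\otimes\imath_Y)(\imath_A\otimes\tau_{A\otimes Y,Y})((\Delta_A\otimes\imath_Y)\overline T\otimes\imath_Y)(\imath_A\otimes\Delta_Y)$.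 The equalities (iii), (iv), (vi) are understood after covering: (iii) after multiplication by $1\otimes1\otimes y'$ on the right and on the left; (iv) after evaluation at $y\otimes a$ and multiplication by $1\otimes a'\otimes y'$ on the right; (vi) after evaluation at $a\otimes y$ and multiplication by $1\otimes a'\otimes 1$ on the left and by $1\otimes1\otimes y'$ on the right. $Y$ is a *(global) left $A$-comodule coalgebra via $\rho$* if $\rho$ is injective, $\rho(Y)(A\otimes1)\subseteq A\otimes Y$, $(A\otimes 1)\rho(Y)\subseteq A\otimes Y$, $(\imath_A\otimes\rho)\rho=(\Delta_A\otimes\imath_Y)\rho$ (as multipliers in $M(A\otimes A\otimes Y)$), and (ii) and (iii) hold. **Proposition.** Let $Y$ be a symmetric partial $A$-comodule coalgebra via $\rho$. Then $Y$ is an $A$-comodule coalgebra via $\rho$ if and only if $$(\imath_A\otimes\varepsilon_Y)\rho(y)=\varepsilon_Y(y)\,1_{M(A)}\quad\text{for all } y\in Y.$$ -/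

import Mathlib

open scoped TensorProduct

noncomputable section

namespace MHopf

section Multiplier

variable (k : Type*) [Field k]

/-- An algebra `B` (possibly without unit) is nondegenerate: `a b = 0` for all `b` forces `a = 0`,
and `a b = 0` for all `a` forces `b = 0`. -/
def Nondegenerate (B : Type*) [NonUnitalRing B] : Prop :=
  (∀ a : B, (∀ b : B, a * b = 0) → a = 0) ∧ (∀ b : B, (∀ a : B, a * b = 0) → b = 0)

variable (B : Type*) [NonUnitalRing B] [Module k B] [SMulCommClass k B B] [IsScalarTower k B B]

/-- The multiplier algebra `M(B)`: the pairs `(X, X₁)` of linear maps on `B` with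
`a X(b) = X₁(a) b`, multiplied by `(X, X₁) (Z, Z₁) = (X ∘ Z, Z₁ ∘ X₁)` (hence the opposite
algebra in the second component). -/
def multiplierSubalgebra : Subalgebra k (Module.End k B × (Module.End k B)ᵐᵒᵖ) where
  carrier := {p | ∀ a b : B, a * p.1 b = p.2.unop a * b}
  mul_mem' := by
    intro p q hp hq a b
    simp only [Set.mem_ofPred_eq] at hp hq
    simp [hp, hq]
  add_mem' := by
    intro p q hp hq a b
    simp only [Set.mem_ofPred_eq] at hp hq
    simp [mul_add, add_mul, hp, hq]
  algebraMap_mem' := by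
    intro r a b
    simp [Module.algebraMap_end_apply, MulOpposite.algebraMap_apply, mul_smul_comm, smul_mul_assoc]

/-- The multiplier algebra `M(B)`. -/
abbrev Multiplier : Type _ := multiplierSubalgebra k B

variable {k B}

/-- `m.L b` is the product `m b` of the multiplier `m` with `b`. -/
def Multiplier.L (m : Multiplier k B) : B →ₗ[k] B := m.1.1

/-- `m.R b` is the product `b m` of `b` with the multiplier `m`. -/
def Multiplier.R (m : Multiplier k B) : B →ₗ[k] B := m.1.2.unop

set_option linter.unusedSectionVars false in
theorem Multiplier.central (m : Multiplier k B) (a b : B) : a * m.L b = m.R a * b := m.2 a b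

variable (k) in
/-- The canonical map `B → M(B)`. -/
def toMult : B →ₗ[k] Multiplier k B where
  toFun b := ⟨(LinearMap.mulLeft k b, MulOpposite.op (LinearMap.mulRight k b)),
    fun x y => by simp [mul_assoc]⟩
  map_add' a b := by
    apply Subtype.ext
    refine Prod.ext ?_ (MulOpposite.unop_injective ?_)
    · ext x; simp [add_mul]
    · ext x; simp [mul_add]
  map_smul' r a := by
    apply Subtype.ext
    refine Prod.ext ?_ (MulOpposite.unop_injective ?_)
    · ext x; simp [smul_mul_assoc]
    · ext x; simp [mul_smul_comm]

variable {C : Type*} [NonUnitalRing C] [Module k C] [SMulCommClass k C C] [IsScalarTower k C C]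

/-- `m ⊗ n ∈ M(B ⊗ C)` for `m ∈ M(B)` and `n ∈ M(C)`. -/
def multTmul (m : Multiplier k B) (n : Multiplier k C) : Multiplier k (B ⊗[k] C) :=
  ⟨(TensorProduct.map m.L n.L, MulOpposite.op (TensorProduct.map m.R n.R)), by
    intro x y
    induction x using TensorProduct.induction_on with
    | zero => simp
    | add x₁ x₂ h₁ h₂ => simp only [add_mul, map_add, h₁, h₂]
    | tmul b c =>
      induction y using TensorProduct.induction_on with
      | zero => simp
      | add y₁ y₂ h₁ h₂ => simp only [mul_add, map_add, h₁, h₂]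
      | tmul b₁ c₁ =>
        simp [Algebra.TensorProduct.tmul_mul_tmul, Multiplier.central]⟩

variable (k B C) in
/-- The bilinear map `M(B) × M(C) → M(B ⊗ C)`, `(m, n) ↦ m ⊗ n`. -/
def multTmulₗ : Multiplier k B →ₗ[k] Multiplier k C →ₗ[k] Multiplier k (B ⊗[k] C) :=
  LinearMap.mk₂ k multTmul
    (fun m₁ m₂ n => Subtype.ext <| Prod.ext (TensorProduct.map_add_left m₁.L m₂.L n.L)
      (MulOpposite.unop_injective (TensorProduct.map_add_left m₁.R m₂.R n.R)))
    (fun c m n => Subtype.ext <| Prod.ext (TensorProduct.map_smul_left c m.L n.L)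
      (MulOpposite.unop_injective (TensorProduct.map_smul_left c m.R n.R)))
    (fun m n₁ n₂ => Subtype.ext <| Prod.ext (TensorProduct.map_add_right m.L n₁.L n₂.L)
      (MulOpposite.unop_injective (TensorProduct.map_add_right m.R n₁.R n₂.R)))
    (fun c m n => Subtype.ext <| Prod.ext (TensorProduct.map_smul_right c m.L n.L)
      (MulOpposite.unop_injective (TensorProduct.map_smul_right c m.R n.R)))

/-- For a homomorphism `f : B → M(C)` and `m ∈ M(B)`, `n ∈ M(C)`, this says that the canonical
extension `M(B) → M(C)` of `f` takes the value `n` at `m`, that is, `n f(b) = f(m b)` and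
`f(b) n = f(b m)` for all `b`. When `f` is nondegenerate (`f(B) C = C = C f(B)`, spans of
products) and `C` is nondegenerate, there is exactly one such `n` for each `m`. -/
def ExtendsTo (f : B →ₗ[k] Multiplier k C) (m : Multiplier k B) (n : Multiplier k C) : Prop :=
  ∀ b : B, n * f b = f (m.L b) ∧ f b * n = f (m.R b)

end Multiplier

/-- The structure of a regular multiplier Hopf algebra on a `k`-algebra `A` (possibly without
unit). The four bijections `T₁, …, T₄` of `A ⊗ A` are the canonical maps; they are determined by
`Δ`, as `A ⊗ A → M(A ⊗ A)` is injective, and their presence says that the elements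
`Δ(a)(1 ⊗ b)`, `(a ⊗ 1)Δ(b)`, `Δ(a)(b ⊗ 1)`, `(1 ⊗ a)Δ(b)` lie in `A ⊗ A` and that the
canonical maps are bijective. -/
structure RegularMultiplierHopf (k : Type*) [Field k] (A : Type*) [NonUnitalRing A] [Module k A]
    [SMulCommClass k A A] [IsScalarTower k A A] where
  /-- the algebra is nondegenerate -/
  nondegenerate : Nondegenerate A
  /-- the comultiplication, an algebra homomorphism into `M(A ⊗ A)` -/
  Δ : A →ₙₐ[k] Multiplier k (A ⊗[k] A)
  /-- `T₁(a ⊗ b) = Δ(a)(1 ⊗ b)` -/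
  T₁ : (A ⊗[k] A) ≃ₗ[k] (A ⊗[k] A)
  /-- `T₂(a ⊗ b) = (a ⊗ 1)Δ(b)` -/
  T₂ : (A ⊗[k] A) ≃ₗ[k] (A ⊗[k] A)
  /-- `T₃(a ⊗ b) = Δ(a)(b ⊗ 1)` -/
  T₃ : (A ⊗[k] A) ≃ₗ[k] (A ⊗[k] A)
  /-- `T₄(a ⊗ b) = (1 ⊗ a)Δ(b)` -/
  T₄ : (A ⊗[k] A) ≃ₗ[k] (A ⊗[k] A)
  T₁_spec : ∀ a b : A, toMult k (T₁ (a ⊗ₜ[k] b)) = Δ a * multTmul 1 (toMult k b)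
  T₂_spec : ∀ a b : A, toMult k (T₂ (a ⊗ₜ[k] b)) = multTmul (toMult k a) 1 * Δ b
  T₃_spec : ∀ a b : A, toMult k (T₃ (a ⊗ₜ[k] b)) = Δ a * multTmul (toMult k b) 1
  T₄_spec : ∀ a b : A, toMult k (T₄ (a ⊗ₜ[k] b)) = multTmul 1 (toMult k a) * Δ b
  /-- coassociativity:
  `(a ⊗ 1 ⊗ 1) (Δ ⊗ ι)(Δ(b)(1 ⊗ c)) = (ι ⊗ Δ)((a ⊗ 1)Δ(b)) (1 ⊗ 1 ⊗ c)` -/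
  coassoc : ∀ a b c : A,
    TensorProduct.assoc k A A A
        (T₂.toLinearMap.rTensor A ((TensorProduct.assoc k A A A).symm (a ⊗ₜ T₁ (b ⊗ₜ c)))) =
      T₁.toLinearMap.lTensor A (TensorProduct.assoc k A A A (T₂ (a ⊗ₜ b) ⊗ₜ c))

section

variable {k : Type*} [Field k]
variable {A : Type*} [NonUnitalRing A] [Module k A] [SMulCommClass k A A] [IsScalarTower k A A]
variable {Y : Type*} [NonUnitalRing Y] [Module k Y] [SMulCommClass k Y Y] [IsScalarTower k Y Y]

/-- `ε` is a counit: an algebra homomorphism with `(ε ⊗ ι)(Δ(a)(1 ⊗ b)) = a b` and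
`(ι ⊗ ε)((a ⊗ 1)Δ(b)) = a b`. -/
def RegularMultiplierHopf.IsCounit (H : RegularMultiplierHopf k A) (ε : A →ₙₐ[k] k) : Prop :=
  (∀ a b : A, TensorProduct.lid k A ((ε : A →ₗ[k] k).rTensor A (H.T₁ (a ⊗ₜ b))) = a * b) ∧
  (∀ a b : A, TensorProduct.rid k A ((ε : A →ₗ[k] k).lTensor A (H.T₂ (a ⊗ₜ b))) = a * b)

/-- The counit of a multiplier Hopf algebra: the unique homomorphism satisfying the counit
identities. -/
def RegularMultiplierHopf.counit (H : RegularMultiplierHopf k A) : A →ₗ[k] k :=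
  ((Classical.epsilon H.IsCounit : A →ₙₐ[k] k) : A →ₗ[k] k)

/-- `ε ⊗ ι_C : B ⊗ C → C` for a functional `ε` on `B`. -/
def sliceLeft {B : Type*} [AddCommGroup B] [Module k B] (ε : B →ₗ[k] k)
    (C : Type*) [AddCommGroup C] [Module k C] : B ⊗[k] C →ₗ[k] C :=
  (TensorProduct.lid k C).toLinearMap ∘ₗ ε.rTensor C

/-- `ι_B ⊗ ε : B ⊗ C → B` for a functional `ε` on `C`. -/
def sliceRight (B : Type*) [AddCommGroup B] [Module k B]
    {C : Type*} [AddCommGroup C] [Module k C] (ε : C →ₗ[k] k) : B ⊗[k] C →ₗ[k] B :=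
  (TensorProduct.rid k B).toLinearMap ∘ₗ ε.lTensor B

/-- `Δ_A ⊗ ι_Y : A ⊗ Y → M(A ⊗ A ⊗ Y)`. -/
def comulTensorId (HA : RegularMultiplierHopf k A) (Y : Type*) [NonUnitalRing Y] [Module k Y]
    [SMulCommClass k Y Y] [IsScalarTower k Y Y] :
    A ⊗[k] Y →ₗ[k] Multiplier k ((A ⊗[k] A) ⊗[k] Y) :=
  TensorProduct.lift
    ((multTmulₗ k (A ⊗[k] A) Y).compl₁₂
      (HA.Δ : A →ₗ[k] Multiplier k (A ⊗[k] A)) (toMult k : Y →ₗ[k] Multiplier k Y))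

/-- `T : Y ⊗ A → A ⊗ Y` is the map `T(y ⊗ a) = ρ(y)(a ⊗ 1)`; there is at most one such map, and
there is one exactly when `ρ(Y)(A ⊗ 1) ⊆ A ⊗ Y`. -/
def IsT (ρ : Y →ₗ[k] Multiplier k (A ⊗[k] Y)) (T : Y ⊗[k] A →ₗ[k] A ⊗[k] Y) : Prop :=
  ∀ (y : Y) (a : A), toMult k (T (y ⊗ₜ a)) = ρ y * multTmul (toMult k a) 1

/-- `Tb : A ⊗ Y → A ⊗ Y` is the map `Tb(a ⊗ y) = (a ⊗ 1)ρ(y)`; there is at most one such map, and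
there is one exactly when `(A ⊗ 1)ρ(Y) ⊆ A ⊗ Y`. -/
def IsTbar (ρ : Y →ₗ[k] Multiplier k (A ⊗[k] Y)) (Tb : A ⊗[k] Y →ₗ[k] A ⊗[k] Y) : Prop :=
  ∀ (a : A) (y : Y), toMult k (Tb (a ⊗ₜ y)) = multTmul (toMult k a) 1 * ρ y

/-- `(ι_A ⊗ ε_Y)ρ(y) = ε_Y(y) 1_{M(A)}`, where `ι_A ⊗ ε_Y` is extended to `M(A ⊗ Y) → M(A)`. -/
def CounitCondition (HY : RegularMultiplierHopf k Y)
    (ρ : Y →ₗ[k] Multiplier k (A ⊗[k] Y)) (y : Y) : Prop :=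
  ExtendsTo (toMult k ∘ₗ sliceRight A HY.counit) (ρ y) (HY.counit y • (1 : Multiplier k A))

/-! ### The multiplier `(ι_Y ⊗ T)(Δ_Y(y) ⊗ a)`

It lives in the completion of the `Y`-bimodule `Y ⊗ A ⊗ Y` (action on the first factor) and is
given by `(y₂ ⊗ 1 ⊗ 1) (ι ⊗ T)(Δ(y) ⊗ a) = (ι ⊗ T)((y₂ ⊗ 1)Δ(y) ⊗ a)` and
`(ι ⊗ T)(Δ(y) ⊗ a) (y₂ ⊗ 1 ⊗ 1) = (ι ⊗ T)(Δ(y)(y₂ ⊗ 1) ⊗ a)`. -/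

/-- `z ∈ Y ⊗ A ⊗ Y` represents `(ι_Y ⊗ T)(Δ_Y(y) ⊗ a) (1 ⊗ 1 ⊗ y₁)`. -/
def IsCoverRight (HY : RegularMultiplierHopf k Y) (T : Y ⊗[k] A →ₗ[k] A ⊗[k] Y)
    (y : Y) (a : A) (y₁ : Y) (z : Y ⊗[k] (A ⊗[k] Y)) : Prop :=
  ∀ y₂ : Y,
    (LinearMap.mulLeft k y₂).rTensor (A ⊗[k] Y) z =
      ((LinearMap.mulRight k y₁).lTensor A).lTensor Y
        (T.lTensor Y (TensorProduct.assoc k Y Y A (HY.T₂ (y₂ ⊗ₜ y) ⊗ₜ a))) ∧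
    (LinearMap.mulRight k y₂).rTensor (A ⊗[k] Y) z =
      ((LinearMap.mulRight k y₁).lTensor A).lTensor Y
        (T.lTensor Y (TensorProduct.assoc k Y Y A (HY.T₃ (y ⊗ₜ y₂) ⊗ₜ a)))

/-- `z ∈ Y ⊗ A ⊗ Y` represents `(1 ⊗ 1 ⊗ y₁) (ι_Y ⊗ T)(Δ_Y(y) ⊗ a)`. -/
def IsCoverLeft (HY : RegularMultiplierHopf k Y) (T : Y ⊗[k] A →ₗ[k] A ⊗[k] Y)
    (y : Y) (a : A) (y₁ : Y) (z : Y ⊗[k] (A ⊗[k] Y)) : Prop :=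
  ∀ y₂ : Y,
    (LinearMap.mulLeft k y₂).rTensor (A ⊗[k] Y) z =
      ((LinearMap.mulLeft k y₁).lTensor A).lTensor Y
        (T.lTensor Y (TensorProduct.assoc k Y Y A (HY.T₂ (y₂ ⊗ₜ y) ⊗ₜ a))) ∧
    (LinearMap.mulRight k y₂).rTensor (A ⊗[k] Y) z =
      ((LinearMap.mulLeft k y₁).lTensor A).lTensor Y
        (T.lTensor Y (TensorProduct.assoc k Y Y A (HY.T₃ (y ⊗ₜ y₂) ⊗ₜ a)))

/-- `((ι_Y ⊗ T)(Δ_Y(y) ⊗ a))(1 ⊗ 1 ⊗ y₁)` and `(1 ⊗ 1 ⊗ y₁)((ι_Y ⊗ T)(Δ_Y(y) ⊗ a))` lie in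
`Y ⊗ A ⊗ Y`, for all `y`, `y₁`, `a`. -/
def CoverCondition (HY : RegularMultiplierHopf k Y) (T : Y ⊗[k] A →ₗ[k] A ⊗[k] Y) : Prop :=
  ∀ (y : Y) (a : A) (y₁ : Y),
    (∃ z, IsCoverRight HY T y a y₁ z) ∧ (∃ z, IsCoverLeft HY T y a y₁ z)

/-- `(ι_A ⊗ Δ_Y)T(y ⊗ a) = (T ⊗ ι_Y)(ι_Y ⊗ T)(Δ_Y(y) ⊗ a)` for all `y, a`, as an equality in the
completion of the `Y`-bimodule `A ⊗ Y ⊗ Y` (action on the third factor): both sides agree after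
multiplication by `1 ⊗ 1 ⊗ y₁` on the right and on the left. -/
def ComulCompat (HY : RegularMultiplierHopf k Y) (T : Y ⊗[k] A →ₗ[k] A ⊗[k] Y) : Prop :=
  ∀ (y : Y) (a : A) (y₁ : Y) (z : Y ⊗[k] (A ⊗[k] Y)),
    (IsCoverRight HY T y a y₁ z →
      HY.T₁.toLinearMap.lTensor A (TensorProduct.assoc k A Y Y (T (y ⊗ₜ a) ⊗ₜ y₁)) =
        TensorProduct.assoc k A Y Y (T.rTensor Y ((TensorProduct.assoc k Y A Y).symm z))) ∧
    (IsCoverLeft HY T y a y₁ z →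
      (HY.T₄.toLinearMap ∘ₗ TensorProduct.mk k Y Y y₁).lTensor A (T (y ⊗ₜ a)) =
        TensorProduct.assoc k A Y Y (T.rTensor Y ((TensorProduct.assoc k Y A Y).symm z)))

/-- Partial coassociativity
`(ι_A ⊗ T)(T ⊗ ι_A)(ι_Y ⊗ Δ_A)
  = ((ι_A ⊗ ε_Y)T ⊗ ι_A ⊗ ι_Y)(ι_Y ⊗ (Δ_A ⊗ ι_Y)T)(Δ_Y ⊗ ι_A)`,
evaluated at `y ⊗ a` and multiplied by `1 ⊗ a₁ ⊗ y₁` on the right. With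
`z = (ι_Y ⊗ T)(Δ_Y(y) ⊗ a)(1 ⊗ 1 ⊗ y₁)` it reads
`(ι_A ⊗ T)(T ⊗ ι_A)(y ⊗ Δ_A(a)(1 ⊗ a₁)) (1 ⊗ 1 ⊗ y₁)
  = ((ι_A ⊗ ε_Y)T ⊗ ι_A ⊗ ι_Y)((ι_Y ⊗ Δ_A ⊗ ι_Y)(z) (1 ⊗ 1 ⊗ a₁ ⊗ 1))`. -/
def PartialCoassoc (HA : RegularMultiplierHopf k A) (HY : RegularMultiplierHopf k Y)
    (T : Y ⊗[k] A →ₗ[k] A ⊗[k] Y) : Prop :=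
  ∀ (y : Y) (a a₁ : A) (y₁ : Y) (z : Y ⊗[k] (A ⊗[k] Y)), IsCoverRight HY T y a y₁ z →
    ((LinearMap.mulRight k y₁).lTensor A).lTensor A
        (T.lTensor A (TensorProduct.assoc k A Y A
          (T.rTensor A ((TensorProduct.assoc k Y A A).symm (y ⊗ₜ HA.T₁ (a ⊗ₜ a₁)))))) =
      (sliceRight A HY.counit ∘ₗ T).rTensor (A ⊗[k] Y)
        ((TensorProduct.assoc k Y A (A ⊗[k] Y)).symm
          ((TensorProduct.assoc k A A Y).toLinearMap.lTensor Y
            (((HA.T₁.toLinearMap ∘ₗ (TensorProduct.mk k A A).flip a₁).rTensor Y).lTensor Y z)))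

/-- `u ∈ A ⊗ Y ⊗ Y` represents `(Tb ⊗ ι_Y)(a ⊗ Δ_Y(y)) (1 ⊗ y₁ ⊗ 1)`. Here
`(Tb ⊗ ι_Y)(a ⊗ Δ_Y(y))` lives in the completion of the `Y`-bimodule `A ⊗ Y ⊗ Y` (action on the
third factor), its products with `1 ⊗ 1 ⊗ y₂` on the right and on the left being
`(Tb ⊗ ι_Y)(a ⊗ Δ_Y(y)(1 ⊗ y₂))` and `(Tb ⊗ ι_Y)(a ⊗ (1 ⊗ y₂)Δ_Y(y))`. -/
def IsCoverBar (HY : RegularMultiplierHopf k Y) (Tb : A ⊗[k] Y →ₗ[k] A ⊗[k] Y)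
    (a : A) (y y₁ : Y) (u : (A ⊗[k] Y) ⊗[k] Y) : Prop :=
  ∀ y₂ : Y,
    (LinearMap.mulRight k y₂).lTensor (A ⊗[k] Y) u =
      ((LinearMap.mulRight k y₁).lTensor A).rTensor Y
        (Tb.rTensor Y ((TensorProduct.assoc k A Y Y).symm (a ⊗ₜ HY.T₁ (y ⊗ₜ y₂)))) ∧
    (LinearMap.mulLeft k y₂).lTensor (A ⊗[k] Y) u =
      ((LinearMap.mulRight k y₁).lTensor A).rTensor Y
        (Tb.rTensor Y ((TensorProduct.assoc k A Y Y).symm (a ⊗ₜ HY.T₄ (y₂ ⊗ₜ y))))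

/-- The symmetric counterpart of partial coassociativity,
`(ι_A ⊗ Tb)(ι_A ⊗ τ)(Tb ⊗ ι_A)(ι_A ⊗ τ)(Δ_A ⊗ ι_Y)
  = ((ι_A ⊗ ε_Y)Tb ⊗ ι_A ⊗ ι_Y)(ι_A ⊗ τ)((Δ_A ⊗ ι_Y)Tb ⊗ ι_Y)(ι_A ⊗ Δ_Y)` (`τ` the flips),
evaluated at `a ⊗ y`, multiplied by `1 ⊗ a₁ ⊗ 1` on the left and by `1 ⊗ 1 ⊗ y₁` on the right. -/
def PartialCoassocBar (HA : RegularMultiplierHopf k A) (HY : RegularMultiplierHopf k Y)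
    (Tb : A ⊗[k] Y →ₗ[k] A ⊗[k] Y) : Prop :=
  ∀ (a a₁ : A) (y y₁ : Y) (u : (A ⊗[k] Y) ⊗[k] Y), IsCoverBar HY Tb a y y₁ u →
    ((LinearMap.mulRight k y₁).lTensor A).lTensor A
        (Tb.lTensor A ((TensorProduct.comm k Y A).toLinearMap.lTensor A
          (TensorProduct.assoc k A Y A (Tb.rTensor A ((TensorProduct.assoc k A Y A).symm
            ((TensorProduct.comm k A Y).toLinearMap.lTensor A
              (TensorProduct.assoc k A A Y (HA.T₄ (a₁ ⊗ₜ a) ⊗ₜ y)))))))) =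
      (sliceRight A HY.counit ∘ₗ Tb).rTensor (A ⊗[k] Y)
        ((TensorProduct.assoc k A Y (A ⊗[k] Y)).symm
          ((TensorProduct.comm k (A ⊗[k] Y) Y).toLinearMap.lTensor A
            (TensorProduct.assoc k A (A ⊗[k] Y) Y
              ((TensorProduct.assoc k A A Y).toLinearMap.rTensor Y
                (((HA.T₄.toLinearMap ∘ₗ TensorProduct.mk k A A a₁).rTensor Y).rTensor Y u)))))

/-- The conditions making `Y` a partial `A`-comodule coalgebra via `ρ`, with
`T(y ⊗ a) = ρ(y)(a ⊗ 1)`. -/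
structure PartialAxioms (HA : RegularMultiplierHopf k A) (HY : RegularMultiplierHopf k Y)
    (ρ : Y →ₗ[k] Multiplier k (A ⊗[k] Y)) (T : Y ⊗[k] A →ₗ[k] A ⊗[k] Y) : Prop where
  isT : IsT ρ T
  /-- `(ε_A ⊗ ι_Y)ρ(y) = y`, where `ε_A ⊗ ι_Y` is extended to `M(A ⊗ Y) → M(Y)` -/
  counit : ∀ y : Y, ExtendsTo (toMult k ∘ₗ sliceLeft HA.counit Y) (ρ y) (toMult k y)
  cover : CoverCondition HY T
  comul : ComulCompat HY T
  coassoc : PartialCoassoc HA HY T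

/-- `Y` is a (left) partial `A`-comodule coalgebra via `ρ`. -/
def IsPartialComoduleCoalgebra (HA : RegularMultiplierHopf k A) (HY : RegularMultiplierHopf k Y)
    (ρ : Y →ₗ[k] Multiplier k (A ⊗[k] Y)) : Prop :=
  ∃ T, PartialAxioms HA HY ρ T

/-- `Y` is a (left) symmetric partial `A`-comodule coalgebra via `ρ`. -/
def IsSymmetricPartialComoduleCoalgebra (HA : RegularMultiplierHopf k A)
    (HY : RegularMultiplierHopf k Y) (ρ : Y →ₗ[k] Multiplier k (A ⊗[k] Y)) : Prop :=
  IsPartialComoduleCoalgebra HA HY ρ ∧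
  ∃ Tb, IsTbar ρ Tb ∧
    PartialCoassocBar HA HY Tb ∧
    ∀ (a : A) (y y₁ : Y), ∃ u : (A ⊗[k] Y) ⊗[k] Y, IsCoverBar HY Tb a y y₁ u

/-- `n ∈ M(A ⊗ A ⊗ Y)` is the multiplier `(ι_A ⊗ ρ)(ρ(y))`:
`n (a ⊗ b ⊗ 1) = (ι_A ⊗ ρ)(ρ(y)(a ⊗ 1)) (1 ⊗ b ⊗ 1)` and
`(a ⊗ b ⊗ 1) n = (1 ⊗ b ⊗ 1) (ι_A ⊗ ρ)((a ⊗ 1)ρ(y))`. -/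
def IsIteratedCoaction (T : Y ⊗[k] A →ₗ[k] A ⊗[k] Y) (Tb : A ⊗[k] Y →ₗ[k] A ⊗[k] Y)
    (y : Y) (n : Multiplier k ((A ⊗[k] A) ⊗[k] Y)) : Prop :=
  ∀ a b : A,
    n * multTmul (toMult k (a ⊗ₜ[k] b)) 1 =
      toMult k ((TensorProduct.assoc k A A Y).symm
        ((T ∘ₗ (TensorProduct.mk k Y A).flip b).lTensor A (T (y ⊗ₜ a)))) ∧
    multTmul (toMult k (a ⊗ₜ[k] b)) 1 * n =
      toMult k ((TensorProduct.assoc k A A Y).symm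
        ((Tb ∘ₗ TensorProduct.mk k A Y b).lTensor A (Tb (a ⊗ₜ y))))

/-- `Y` is a left `A`-comodule via `ρ`: `ρ` is injective, `ρ(Y)(A ⊗ 1) ⊆ A ⊗ Y`,
`(A ⊗ 1)ρ(Y) ⊆ A ⊗ Y`, and `(ι_A ⊗ ρ)ρ(y) = (Δ_A ⊗ ι_Y)ρ(y)` in `M(A ⊗ A ⊗ Y)`, where
`Δ_A ⊗ ι_Y` is extended to `M(A ⊗ Y)`. -/
def IsLeftComodule (HA : RegularMultiplierHopf k A)
    (ρ : Y →ₗ[k] Multiplier k (A ⊗[k] Y)) : Prop :=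
  Function.Injective ρ ∧
  ∃ T Tb, IsT ρ T ∧ IsTbar ρ Tb ∧
    ∀ y : Y, ∃ n, IsIteratedCoaction T Tb y n ∧ ExtendsTo (comulTensorId HA Y) (ρ y) n

/-- `Y` is a (global, left) `A`-comodule coalgebra via `ρ`. -/
def IsComoduleCoalgebra (HA : RegularMultiplierHopf k A) (HY : RegularMultiplierHopf k Y)
    (ρ : Y →ₗ[k] Multiplier k (A ⊗[k] Y)) : Prop :=
  IsLeftComodule HA ρ ∧ ∃ T, IsT ρ T ∧ CoverCondition HY T ∧ ComulCompat HY T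

end

end MHopf

end

noncomputable section

/-! Write θ = (ι ⊗ ε_Y)T : Y ⊗ A → A. The counit condition says exactly that θ(y ⊗ a) = ε_Y(y)a
(`counitCondition_iff`). The left side of partial coassociativity is the covered form of (ι ⊗ ρ)ρ,
and its right side is that of (Δ_A ⊗ ι)ρ twisted by θ on an extra leg.

If the counit condition holds, θ only applies ε_Y to that leg, and the counit property of Δ_Y turns
the right side into (Δ_A ⊗ ι)T (`coassocRight_of_counit`, `IsCoverRight.sliceLeft_counit`). The
symmetric axiom does the same for the left cover (`PartialCoassocBar.iterTbar_eq`). The two covered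
identities together give equality of multipliers (`extendsTo_comulTensorId`), and ρ is injective
because (ε_A ⊗ ι)ρ(y) = y.

Conversely, compare partial with global coassociativity and apply ε_Y to the last leg. With z'
standing for y₍₁₎ ⊗ θ(y₍₂₎ ⊗ a), this gives (θ ⊗ ι)(ι ⊗ Δ_A)(z') = Δ_A(θ(y ⊗ a)). Cover by 1 ⊗ c on
the left and apply x ⊗ v ↦ x S(v). Since θ is right A-linear and b₍₁₎S(c b₍₂₎) = ε_A(b)S(c), there
remains θ((ι ⊗ ε_A)(z') ⊗ S(c)) = ε_A(θ(y ⊗ a)) S(c). For ε_A(a) = 1, the axiom (ε_A ⊗ ι)ρ = ι makes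
the left side θ(y ⊗ S(c)) and the scalar ε_Y(y). Surjectivity of S concludes
(`sliceRight_counit_of_coassoc`).

The counit is defined by choice and the antipode is not part of the structure, so both are first
constructed from the canonical maps (`exists_isCounit`, `exists_antipode`). -/

namespace MHopf

set_option linter.unusedSectionVars false

/-! ### Jointly injective families and tensor products. -/

section Separation

variable {k : Type*} [Field k]
variable {V V' W W' : Type*} [AddCommGroup V] [Module k V] [AddCommGroup V'] [Module k V']
  [AddCommGroup W] [Module k W] [AddCommGroup W'] [Module k W']

/-- A jointly injective family of linear maps stays jointly injective after `- ⊗ W`. -/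
theorem eq_of_forall_rTensor_eq {ι : Sort*} (f : ι → V →ₗ[k] V')
    (hf : ∀ v, (∀ i, f i v = 0) → v = 0) {u u' : V ⊗[k] W}
    (h : ∀ i, (f i).rTensor W u = (f i).rTensor W u') : u = u' := by
  classical
  -- A basis of W identifies V ⊗ W with finitely supported families in V, on which `f i` acts
  -- coordinatewise.
  let b := Module.Basis.ofVectorSpace k W
  have key : ∀ (i : ι) (x : V ⊗[k] W) (j), TensorProduct.equivFinsuppOfBasisRight b
      ((f i).rTensor W x) j = f i (TensorProduct.equivFinsuppOfBasisRight b x j) := by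
    intro i x j
    induction x using TensorProduct.induction_on with
    | zero => simp
    | add x y hx hy => simp only [map_add, Finsupp.add_apply, hx, hy]
    | tmul v w => simp
  apply (TensorProduct.equivFinsuppOfBasisRight (M := V) b).injective
  ext j
  rw [← sub_eq_zero]
  refine hf _ fun i => ?_
  rw [map_sub, ← key, ← key, h i, sub_self]

/-- A jointly injective family of linear maps stays jointly injective after `W ⊗ -`. -/
theorem eq_of_forall_lTensor_eq {ι : Sort*} (f : ι → V →ₗ[k] V')
    (hf : ∀ v, (∀ i, f i v = 0) → v = 0) {u u' : W ⊗[k] V}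
    (h : ∀ i, (f i).lTensor W u = (f i).lTensor W u') : u = u' := by
  apply (TensorProduct.comm k W V).injective
  refine eq_of_forall_rTensor_eq f hf fun i => ?_
  have key : ∀ x : W ⊗[k] V, (f i).rTensor W (TensorProduct.comm k W V x) =
      TensorProduct.comm k W V' ((f i).lTensor W x) := fun x =>
    LinearMap.congr_fun (TensorProduct.ext' (g := (f i).rTensor W ∘ₗ
      (TensorProduct.comm k W V).toLinearMap) (h := (TensorProduct.comm k W V').toLinearMap ∘ₗ
        (f i).lTensor W) fun w v => by simp) x
  rw [key, key, h i]

end Separation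

/-! ### Nondegenerate algebras and their multipliers. -/

section Algebra

variable {k : Type*} [Field k]
variable {B : Type*} [NonUnitalRing B] [Module k B] [SMulCommClass k B B] [IsScalarTower k B B]
variable {C : Type*} [NonUnitalRing C] [Module k C] [SMulCommClass k C C] [IsScalarTower k C C]

theorem Nondegenerate.eq_of_mul_right (hB : Nondegenerate B) {a a' : B}
    (h : ∀ b, a * b = a' * b) : a = a' :=
  sub_eq_zero.1 (hB.1 _ fun b => by rw [sub_mul, h, sub_self])

theorem Nondegenerate.eq_of_mul_left (hB : Nondegenerate B) {a a' : B}
    (h : ∀ b, b * a = b * a') : a = a' :=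
  sub_eq_zero.1 (hB.2 _ fun b => by rw [mul_sub, h, sub_self])

theorem Nondegenerate.eq_of_rTensor_mulLeft (hB : Nondegenerate B)
    {W : Type*} [AddCommGroup W] [Module k W] {u u' : B ⊗[k] W}
    (h : ∀ b, (LinearMap.mulLeft k b).rTensor W u = (LinearMap.mulLeft k b).rTensor W u') :
    u = u' :=
  eq_of_forall_rTensor_eq (V := B) (V' := B) (ι := B) (LinearMap.mulLeft k) (hB.2) h

theorem Nondegenerate.eq_of_rTensor_mulRight (hB : Nondegenerate B)
    {W : Type*} [AddCommGroup W] [Module k W] {u u' : B ⊗[k] W}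
    (h : ∀ b, (LinearMap.mulRight k b).rTensor W u = (LinearMap.mulRight k b).rTensor W u') :
    u = u' :=
  eq_of_forall_rTensor_eq (V := B) (V' := B) (ι := B) (LinearMap.mulRight k) (hB.1) h

theorem Nondegenerate.eq_of_lTensor_mulLeft (hB : Nondegenerate B)
    {W : Type*} [AddCommGroup W] [Module k W] {u u' : W ⊗[k] B}
    (h : ∀ b, (LinearMap.mulLeft k b).lTensor W u = (LinearMap.mulLeft k b).lTensor W u') :
    u = u' :=
  eq_of_forall_lTensor_eq (V := B) (V' := B) (ι := B) (LinearMap.mulLeft k) (hB.2) h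

theorem Nondegenerate.eq_of_lTensor_mulRight (hB : Nondegenerate B)
    {W : Type*} [AddCommGroup W] [Module k W] {u u' : W ⊗[k] B}
    (h : ∀ b, (LinearMap.mulRight k b).lTensor W u = (LinearMap.mulRight k b).lTensor W u') :
    u = u' :=
  eq_of_forall_lTensor_eq (V := B) (V' := B) (ι := B) (LinearMap.mulRight k) (hB.1) h

theorem tmul_mul_eq (b : B) (c : C) (u : B ⊗[k] C) :
    (b ⊗ₜ[k] c) * u = (LinearMap.mulLeft k b).rTensor C ((LinearMap.mulLeft k c).lTensor B u) := by
  induction u using TensorProduct.induction_on with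
  | zero => simp
  | add x y hx hy => simp only [mul_add, map_add, hx, hy]
  | tmul x y => simp [Algebra.TensorProduct.tmul_mul_tmul]

theorem mul_tmul_eq (b : B) (c : C) (u : B ⊗[k] C) :
    u * (b ⊗ₜ[k] c) =
      (LinearMap.mulRight k b).rTensor C ((LinearMap.mulRight k c).lTensor B u) := by
  induction u using TensorProduct.induction_on with
  | zero => simp
  | add x y hx hy => simp only [add_mul, map_add, hx, hy]
  | tmul x y => simp [Algebra.TensorProduct.tmul_mul_tmul]

theorem Nondegenerate.tensorProduct (hB : Nondegenerate B) (hC : Nondegenerate C) :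
    Nondegenerate (B ⊗[k] C) := by
  constructor
  · intro u hu
    refine hC.eq_of_lTensor_mulRight (k := k) fun c => hB.eq_of_rTensor_mulRight fun b => ?_
    rw [← mul_tmul_eq, hu]; simp
  · intro u hu
    refine hC.eq_of_lTensor_mulLeft (k := k) fun c => hB.eq_of_rTensor_mulLeft fun b => ?_
    rw [← tmul_mul_eq, hu]; simp

@[simp] theorem toMult_L (a b : B) : (toMult k a).L b = a * b := rfl
@[simp] theorem toMult_R (a b : B) : (toMult k a).R b = b * a := rfl
@[simp] theorem Multiplier.mul_L (m n : Multiplier k B) (b : B) : (m * n).L b = m.L (n.L b) := rfl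
@[simp] theorem Multiplier.mul_R (m n : Multiplier k B) (b : B) : (m * n).R b = n.R (m.R b) := rfl
@[simp] theorem Multiplier.one_L : (1 : Multiplier k B).L = LinearMap.id := rfl
@[simp] theorem Multiplier.one_R : (1 : Multiplier k B).R = LinearMap.id := rfl
@[simp] theorem multTmul_L (m : Multiplier k B) (n : Multiplier k C) :
    (multTmul m n).L = TensorProduct.map m.L n.L := rfl
@[simp] theorem multTmul_R (m : Multiplier k B) (n : Multiplier k C) :
    (multTmul m n).R = TensorProduct.map m.R n.R := rfl

theorem Multiplier.ext_of_L_R {m n : Multiplier k B} (hL : ∀ b, m.L b = n.L b)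
    (hR : ∀ b, m.R b = n.R b) : m = n :=
  Subtype.ext <| Prod.ext (LinearMap.ext hL) (MulOpposite.unop_injective (LinearMap.ext hR))

theorem Multiplier.ext_of_L (hB : Nondegenerate B) {m n : Multiplier k B}
    (hL : ∀ b, m.L b = n.L b) : m = n :=
  ext_of_L_R hL fun b => hB.eq_of_mul_right fun c => by rw [← central, ← central, hL]

theorem Multiplier.ext_of_R (hB : Nondegenerate B) {m n : Multiplier k B}
    (hR : ∀ b, m.R b = n.R b) : m = n :=
  ext_of_L_R (fun b => hB.eq_of_mul_left fun c => by rw [central, central, hR]) hR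

theorem toMult_injective (hB : Nondegenerate B) : Function.Injective (toMult k : B → _) := by
  intro a b h
  refine hB.eq_of_mul_right fun c => ?_
  have := congrArg (fun m => Multiplier.L m c) h
  simpa using this

theorem Multiplier.L_mul (hB : Nondegenerate B) (m : Multiplier k B) (b c : B) :
    m.L (b * c) = m.L b * c :=
  hB.eq_of_mul_left fun x => by rw [central, ← mul_assoc, ← mul_assoc, central]

theorem Multiplier.R_mul (hB : Nondegenerate B) (m : Multiplier k B) (b c : B) :
    m.R (b * c) = b * m.R c :=
  hB.eq_of_mul_right fun x => by rw [← central, mul_assoc, mul_assoc, central]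

theorem mul_toMult (hB : Nondegenerate B) (m : Multiplier k B) (b : B) :
    m * toMult k b = toMult k (m.L b) :=
  Multiplier.ext_of_L hB fun c => by simp [Multiplier.L_mul hB]

theorem toMult_mul (hB : Nondegenerate B) (m : Multiplier k B) (b : B) :
    toMult k b * m = toMult k (m.R b) :=
  Multiplier.ext_of_R hB fun c => by simp [Multiplier.R_mul hB]

end Algebra

/-! ### Multipliers of a tensor product, covered in one leg. -/

section TensorMultiplier

variable {k : Type*} [Field k]
variable {B : Type*} [NonUnitalRing B] [Module k B] [SMulCommClass k B B] [IsScalarTower k B B]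
variable {C : Type*} [NonUnitalRing C] [Module k C] [SMulCommClass k C C] [IsScalarTower k C C]

theorem mul_lTensor_mulRight (c : C) (u v : B ⊗[k] C) :
    u * (LinearMap.mulRight k c).lTensor B v = (LinearMap.mulRight k c).lTensor B (u * v) := by
  induction u using TensorProduct.induction_on with
  | zero => simp
  | add x y hx hy => simp only [add_mul, map_add, hx, hy]
  | tmul x y =>
    induction v using TensorProduct.induction_on with
    | zero => simp
    | add x y hx hy => simp only [mul_add, map_add, hx, hy]
    | tmul x' y' => simp [Algebra.TensorProduct.tmul_mul_tmul, mul_assoc]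

theorem lTensor_mulLeft_mul (c : C) (u v : B ⊗[k] C) :
    (LinearMap.mulLeft k c).lTensor B u * v = (LinearMap.mulLeft k c).lTensor B (u * v) := by
  induction u using TensorProduct.induction_on with
  | zero => simp
  | add x y hx hy => simp only [add_mul, map_add, hx, hy]
  | tmul x y =>
    induction v using TensorProduct.induction_on with
    | zero => simp
    | add x y hx hy => simp only [mul_add, map_add, hx, hy]
    | tmul x' y' => simp [Algebra.TensorProduct.tmul_mul_tmul, mul_assoc]

theorem rTensor_mulLeft_mul (b : B) (u v : B ⊗[k] C) :
    (LinearMap.mulLeft k b).rTensor C u * v = (LinearMap.mulLeft k b).rTensor C (u * v) := by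
  induction u using TensorProduct.induction_on with
  | zero => simp
  | add x y hx hy => simp only [add_mul, map_add, hx, hy]
  | tmul x y =>
    induction v using TensorProduct.induction_on with
    | zero => simp
    | add x y hx hy => simp only [mul_add, map_add, hx, hy]
    | tmul x' y' => simp [Algebra.TensorProduct.tmul_mul_tmul, mul_assoc]

theorem mul_rTensor_mulLeft (b : B) (u v : B ⊗[k] C) :
    u * (LinearMap.mulLeft k b).rTensor C v = (LinearMap.mulRight k b).rTensor C u * v := by
  induction u using TensorProduct.induction_on with
  | zero => simp
  | add x y hx hy => simp only [add_mul, map_add, hx, hy]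
  | tmul x y =>
    induction v using TensorProduct.induction_on with
    | zero => simp
    | add x y hx hy => simp only [mul_add, map_add, hx, hy]
    | tmul x' y' => simp [Algebra.TensorProduct.tmul_mul_tmul, mul_assoc]

theorem mul_lTensor_mulLeft (c : C) (u v : B ⊗[k] C) :
    u * (LinearMap.mulLeft k c).lTensor B v = (LinearMap.mulRight k c).lTensor B u * v := by
  induction u using TensorProduct.induction_on with
  | zero => simp
  | add x y hx hy => simp only [add_mul, map_add, hx, hy]
  | tmul x y =>
    induction v using TensorProduct.induction_on with
    | zero => simp
    | add x y hx hy => simp only [mul_add, map_add, hx, hy]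
    | tmul x' y' => simp [Algebra.TensorProduct.tmul_mul_tmul, mul_assoc]

theorem lTensor_rTensor_comm {V V' W W' : Type*} [AddCommGroup V] [Module k V] [AddCommGroup V']
    [Module k V'] [AddCommGroup W] [Module k W] [AddCommGroup W'] [Module k W']
    (f : V →ₗ[k] V') (g : W →ₗ[k] W') (u : V ⊗[k] W) :
    g.lTensor V' (f.rTensor W u) = f.rTensor W' (g.lTensor V u) := by
  rw [← LinearMap.comp_apply, ← LinearMap.comp_apply, LinearMap.lTensor_comp_rTensor,
    LinearMap.rTensor_comp_lTensor]

theorem multTmul_toMult_one_L (b : B) :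
    (multTmul (toMult k b) (1 : Multiplier k C)).L = (LinearMap.mulLeft k b).rTensor C := rfl
theorem multTmul_toMult_one_R (b : B) :
    (multTmul (toMult k b) (1 : Multiplier k C)).R = (LinearMap.mulRight k b).rTensor C := rfl
theorem multTmul_one_toMult_R (c : C) :
    (multTmul (1 : Multiplier k B) (toMult k c)).R = (LinearMap.mulRight k c).lTensor B := rfl

/-- If `m (b ⊗ 1) = g` then `m (b ⊗ c) = g (1 ⊗ c)`. -/
theorem Multiplier.L_tmul_of_mul_left (hBC : Nondegenerate (B ⊗[k] C))
    {m : Multiplier k (B ⊗[k] C)} {b : B} {g : B ⊗[k] C}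
    (h : m * multTmul (toMult k b) 1 = toMult k g) (c : C) :
    m.L (b ⊗ₜ c) = (LinearMap.mulRight k c).lTensor B g := by
  refine hBC.eq_of_mul_left fun u => ?_
  have h' : (LinearMap.mulRight k b).rTensor C (m.R u) = u * g :=
    congrArg (fun n => Multiplier.R n u) h
  rw [central, mul_lTensor_mulRight, mul_tmul_eq, ← h', lTensor_rTensor_comm]

/-- If `(b ⊗ 1) m = g` then `(b ⊗ c) m = (1 ⊗ c) g`. -/
theorem Multiplier.R_tmul_of_mul_left (hBC : Nondegenerate (B ⊗[k] C))
    {m : Multiplier k (B ⊗[k] C)} {b : B} {g : B ⊗[k] C}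
    (h : multTmul (toMult k b) 1 * m = toMult k g) (c : C) :
    m.R (b ⊗ₜ c) = (LinearMap.mulLeft k c).lTensor B g := by
  refine hBC.eq_of_mul_right fun u => ?_
  have h' : (LinearMap.mulLeft k b).rTensor C (m.L u) = g * u :=
    congrArg (fun n => Multiplier.L n u) h
  rw [← central, lTensor_mulLeft_mul, tmul_mul_eq, ← h', lTensor_rTensor_comm]

/-- If `(1 ⊗ c) m = g` then `(b ⊗ c) m = (b ⊗ 1) g`. -/
theorem Multiplier.R_tmul_of_mul_right (hBC : Nondegenerate (B ⊗[k] C))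
    {m : Multiplier k (B ⊗[k] C)} {c : C} {g : B ⊗[k] C}
    (h : multTmul 1 (toMult k c) * m = toMult k g) (b : B) :
    m.R (b ⊗ₜ c) = (LinearMap.mulLeft k b).rTensor C g := by
  refine hBC.eq_of_mul_right fun u => ?_
  have h' : (LinearMap.mulLeft k c).lTensor B (m.L u) = g * u :=
    congrArg (fun n => Multiplier.L n u) h
  rw [← central, tmul_mul_eq, h', rTensor_mulLeft_mul]

end TensorMultiplier

/-! ### Exchange rules for the canonical maps, and existence of the counit. -/

section Counit

variable {k : Type*} [Field k]
variable {A : Type*} [NonUnitalRing A] [Module k A] [SMulCommClass k A A] [IsScalarTower k A A]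

@[simp] theorem sliceLeft_tmul {V W : Type*} [AddCommGroup V] [Module k V] [AddCommGroup W]
    [Module k W] (ε : V →ₗ[k] k) (v : V) (w : W) : sliceLeft ε W (v ⊗ₜ w) = ε v • w := by
  simp [sliceLeft]

@[simp] theorem sliceRight_tmul {V W : Type*} [AddCommGroup V] [Module k V] [AddCommGroup W]
    [Module k W] (ε : V →ₗ[k] k) (v : V) (w : W) : sliceRight W ε (w ⊗ₜ v) = ε v • w := by
  simp [sliceRight]

namespace RegularMultiplierHopf

variable (H : RegularMultiplierHopf k A)

theorem nondegenerate_tensor (H : RegularMultiplierHopf k A) : Nondegenerate (A ⊗[k] A) :=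
  H.nondegenerate.tensorProduct H.nondegenerate

/-- Associativity of the triple product (1 ⊗ c)Δ(s)(1 ⊗ a). It converts left covers of Δ into right
covers. -/
theorem lTensor_mulRight_T₄ (c s a : A) :
    (LinearMap.mulRight k a).lTensor A (H.T₄ (c ⊗ₜ s)) =
      (LinearMap.mulLeft k c).lTensor A (H.T₁ (s ⊗ₜ a)) := by
  refine H.nondegenerate_tensor.eq_of_mul_left fun u => ?_
  have h₄ : (H.Δ s).R ((LinearMap.mulRight k c).lTensor A u) = u * H.T₄ (c ⊗ₜ s) :=
    congrArg (fun n => Multiplier.R n u) (H.T₄_spec c s).symm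
  have h₁ := fun v => congrArg (fun n => Multiplier.R n v) (H.T₁_spec s a)
  simp only [toMult_R, Multiplier.mul_R, multTmul_one_toMult_R] at h₁
  rw [mul_lTensor_mulRight, mul_lTensor_mulLeft, ← h₄, h₁]

theorem lTensor_mulRight_T₂ (a b c : A) :
    (LinearMap.mulRight k c).lTensor A (H.T₂ (a ⊗ₜ b)) =
      (LinearMap.mulLeft k a).rTensor A (H.T₁ (b ⊗ₜ c)) := by
  refine H.nondegenerate_tensor.eq_of_mul_left fun u => ?_
  have h₂ : (H.Δ b).R ((LinearMap.mulRight k a).rTensor A u) = u * H.T₂ (a ⊗ₜ b) :=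
    congrArg (fun n => Multiplier.R n u) (H.T₂_spec a b).symm
  have h₁ := fun v => congrArg (fun n => Multiplier.R n v) (H.T₁_spec b c)
  simp only [toMult_R, Multiplier.mul_R, multTmul_one_toMult_R] at h₁
  rw [mul_lTensor_mulRight, mul_rTensor_mulLeft, ← h₂, h₁]

theorem Δ_R_tmul (p q b : A) :
    (H.Δ b).R (p ⊗ₜ q) = (LinearMap.mulLeft k q).lTensor A (H.T₂ (p ⊗ₜ b)) :=
  Multiplier.R_tmul_of_mul_left H.nondegenerate_tensor (H.T₂_spec p b).symm q

theorem Δ_R_tmul' (p q b : A) :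
    (H.Δ b).R (p ⊗ₜ q) = (LinearMap.mulLeft k p).rTensor A (H.T₄ (q ⊗ₜ b)) :=
  Multiplier.R_tmul_of_mul_right H.nondegenerate_tensor (H.T₄_spec q b).symm p

theorem T₂_tmul_mul (c a b : A) : H.T₂ (c ⊗ₜ (a * b)) = (H.Δ b).R (H.T₂ (c ⊗ₜ a)) := by
  apply toMult_injective (k := k) H.nondegenerate_tensor
  rw [← toMult_mul H.nondegenerate_tensor, H.T₂_spec, H.T₂_spec, map_mul, mul_assoc]

theorem T₂_mul_tmul (a' a b : A) :
    H.T₂ ((a' * a) ⊗ₜ b) = (LinearMap.mulLeft k a').rTensor A (H.T₂ (a ⊗ₜ b)) := by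
  refine H.nondegenerate.eq_of_lTensor_mulRight fun c => ?_
  rw [lTensor_mulRight_T₂, lTensor_rTensor_comm, lTensor_mulRight_T₂, LinearMap.mulLeft_mul,
    LinearMap.rTensor_comp]
  rfl

/-- For u = T₂(a ⊗ b) both sides are ab ⊗ c. Coassociativity says that T₂ on the first two legs
commutes with T₁ on the last two, so T₁⁻¹ can be moved past T₂. Multiplying the last two legs then
turns T₂ into (a ⊗ 1)T₁, which cancels T₁⁻¹. -/
theorem lTensor_mul'_T₁_symm (u : A ⊗[k] A) (c : A) :
    (LinearMap.mul' k A ∘ₗ H.T₁.symm.toLinearMap).lTensor A (TensorProduct.assoc k A A A (u ⊗ₜ c)) =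
      LinearMap.mul' k A (H.T₂.symm u) ⊗ₜ c := by
  obtain ⟨u, rfl⟩ := H.T₂.surjective u
  rw [LinearEquiv.symm_apply_apply]
  induction u using TensorProduct.induction_on with
  | zero => simp
  | add x y hx hy => simp only [map_add, TensorProduct.add_tmul, hx, hy]
  | tmul a b =>
    have coassoc' : ∀ w : A ⊗[k] A, TensorProduct.assoc k A A A
        (H.T₂.toLinearMap.rTensor A ((TensorProduct.assoc k A A A).symm (a ⊗ₜ H.T₁ w))) =
        H.T₁.toLinearMap.lTensor A (TensorProduct.assoc k A A A
          (H.T₂.toLinearMap.rTensor A ((TensorProduct.assoc k A A A).symm (a ⊗ₜ w)))) := by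
      intro w
      induction w using TensorProduct.induction_on with
      | zero => simp
      | add x y hx hy => simp only [map_add, TensorProduct.tmul_add, hx, hy]
      | tmul b c => simpa using H.coassoc a b c
    have mul_apply : ∀ w : A ⊗[k] A, (LinearMap.mul' k A).lTensor A (TensorProduct.assoc k A A A
          (H.T₂.toLinearMap.rTensor A ((TensorProduct.assoc k A A A).symm (a ⊗ₜ w)))) =
        (LinearMap.mulLeft k a).rTensor A (H.T₁ w) := by
      intro w
      induction w using TensorProduct.induction_on with
      | zero => simp
      | add x y hx hy => simp only [map_add, TensorProduct.tmul_add, hx, hy]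
      | tmul p q =>
        rw [← H.lTensor_mulRight_T₂]
        simp only [TensorProduct.assoc_symm_tmul, LinearMap.rTensor_tmul, LinearEquiv.coe_coe]
        induction H.T₂ (a ⊗ₜ p) using TensorProduct.induction_on with
        | zero => simp
        | add x y hx hy => simp only [map_add, TensorProduct.add_tmul, hx, hy]
        | tmul r s => simp
    have h := coassoc' (H.T₁.symm (b ⊗ₜ c))
    rw [LinearEquiv.apply_symm_apply] at h
    have h' := congrArg (H.T₁.symm.toLinearMap.lTensor A) h
    rw [← LinearMap.comp_apply (LinearMap.lTensor A H.T₁.symm.toLinearMap)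
      (LinearMap.lTensor A H.T₁.toLinearMap), ← LinearMap.lTensor_comp, LinearEquiv.symm_comp,
      LinearMap.lTensor_id, LinearMap.id_apply] at h'
    rw [LinearMap.lTensor_comp, LinearMap.comp_apply]
    have e : H.T₂ (a ⊗ₜ b) ⊗ₜ c = H.T₂.toLinearMap.rTensor A
      ((TensorProduct.assoc k A A A).symm (a ⊗ₜ (b ⊗ₜ c))) := by simp
    rw [e, h', mul_apply]
    simp

theorem sliceRight_lTensor_mulLeft {W : Type*} [AddCommGroup W] [Module k W] {ε : A →ₗ[k] k}
    (hε : ∀ a b, ε (a * b) = ε a * ε b) (a : A) (u : W ⊗[k] A) :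
    sliceRight W ε ((LinearMap.mulLeft k a).lTensor W u) = ε a • sliceRight W ε u := by
  induction u using TensorProduct.induction_on with
  | zero => simp
  | add x y hx hy => simp only [map_add, smul_add, hx, hy]
  | tmul p q => simp [hε, mul_smul]

theorem exists_isCounit : ∃ ε, H.IsCounit ε := by
  rcases subsingleton_or_nontrivial A with hA | hA
  · exact ⟨0, fun a b => Subsingleton.elim _ _, fun a b => Subsingleton.elim _ _⟩
  obtain ⟨p, hp⟩ := exists_ne (0 : A)
  obtain ⟨ω, hω⟩ : ∃ ω : A →ₗ[k] k, ω p = 1 := by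
    obtain ⟨f, hf⟩ : ∃ f : Module.Dual k A, f p ≠ 0 := by
      by_contra! h
      exact hp ((Module.forall_dual_apply_eq_zero_iff k p).1 h)
    exact ⟨(f p)⁻¹ • f, by simp [hf]⟩
  -- Here p sits untouched on one side and c on the other, so m T₁⁻¹(q ⊗ c) is a scalar multiple of
  -- c and m T₂⁻¹(p ⊗ q) is the same multiple of p. That scalar is ε(q), extracted with ω(p) = 1.
  have key : ∀ p q c : A, p ⊗ₜ[k] LinearMap.mul' k A (H.T₁.symm (q ⊗ₜ c)) =
      LinearMap.mul' k A (H.T₂.symm (p ⊗ₜ q)) ⊗ₜ c := fun p q c => by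
    simpa using H.lTensor_mul'_T₁_symm (p ⊗ₜ q) c
  let ε : A →ₗ[k] k := ω ∘ₗ LinearMap.mul' k A ∘ₗ H.T₂.symm.toLinearMap ∘ₗ TensorProduct.mk k A A p
  have h₁ : ∀ q c : A, LinearMap.mul' k A (H.T₁.symm (q ⊗ₜ c)) = ε q • c := fun q c => by
    simpa [hω, ε] using congrArg (sliceLeft ω A) (key p q c)
  have h₂ : ∀ p' q : A, LinearMap.mul' k A (H.T₂.symm (p' ⊗ₜ q)) = ε q • p' := fun p' q => by
    have := congrArg (sliceRight A ω) (key p' q p)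
    rw [h₁] at this
    simpa [hω] using this.symm
  have s₁ : ∀ a b, sliceLeft ε A (H.T₁ (a ⊗ₜ b)) = a * b := by
    have : sliceLeft ε A = LinearMap.mul' k A ∘ₗ H.T₁.symm.toLinearMap :=
      TensorProduct.ext' fun q c => by simp [h₁]
    intro a b
    simp [this]
  have s₂ : ∀ a b, sliceRight A ε (H.T₂ (a ⊗ₜ b)) = a * b := by
    have : sliceRight A ε = LinearMap.mul' k A ∘ₗ H.T₂.symm.toLinearMap :=
      TensorProduct.ext' fun q c => by simp [h₂]
    intro a b
    simp [this]
  -- Multiplicativity of ε comes from that of Δ: (ι ⊗ ε)(uΔ(b)) = (ι ⊗ ε)(u) b. Taking u = r ⊗ q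
  -- gives `s₄` on the element T₂(r ⊗ b), and such elements span.
  have s₃ : ∀ b u, sliceRight A ε ((H.Δ b).R u) = sliceRight A ε u * b := by
    intro b u
    obtain ⟨u, rfl⟩ := H.T₂.surjective u
    induction u using TensorProduct.induction_on with
    | zero => simp
    | add x y hx hy => simp only [map_add, add_mul, hx, hy]
    | tmul c a => rw [← H.T₂_tmul_mul, s₂, s₂, mul_assoc]
  have s₄ : ∀ q v, sliceRight A ε ((LinearMap.mulLeft k q).lTensor A v) =
      ε q • sliceRight A ε v := by
    intro q v
    obtain ⟨v, rfl⟩ := H.T₂.surjective v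
    induction v using TensorProduct.induction_on with
    | zero => simp
    | add x y hx hy => simp only [map_add, smul_add, hx, hy]
    | tmul r b => rw [← Δ_R_tmul, s₃, s₂, sliceRight_tmul, smul_mul_assoc]
  have hmul : ∀ q s, ε (q * s) = ε q * ε s := fun q s => by
    simpa [hω] using congrArg ω (s₄ q (p ⊗ₜ s))
  exact ⟨{ ε with map_mul' := hmul, map_zero' := ε.map_zero }, s₁, s₂⟩

theorem counit_spec : H.IsCounit (Classical.epsilon H.IsCounit) :=
  Classical.epsilon_spec H.exists_isCounit

theorem counit_mul (a b : A) : H.counit (a * b) = H.counit a * H.counit b :=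
  map_mul (Classical.epsilon H.IsCounit : A →ₙₐ[k] k) a b

theorem sliceLeft_counit_T₁ (a b : A) : sliceLeft H.counit A (H.T₁ (a ⊗ₜ b)) = a * b :=
  H.counit_spec.1 a b

theorem sliceRight_counit_T₂ (a b : A) : sliceRight A H.counit (H.T₂ (a ⊗ₜ b)) = a * b :=
  H.counit_spec.2 a b

theorem exists_counit_eq_one [Nontrivial A] : ∃ e, H.counit e = 1 := by
  by_contra! h
  have h0 : H.counit = 0 := by
    ext a
    by_contra ha
    exact h ((H.counit a)⁻¹ • a) (by simpa using inv_mul_cancel₀ ha)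
  obtain ⟨p, hp⟩ := exists_ne (0 : A)
  refine hp (H.nondegenerate.1 p fun b => ?_)
  rw [← H.sliceLeft_counit_T₁, h0]
  simp [sliceLeft]

end RegularMultiplierHopf

end Counit

/-! ### Slicing by functionals. -/

section Slices

variable {k : Type*} [Field k]
variable {V V' W W' : Type*} [AddCommGroup V] [Module k V] [AddCommGroup V'] [Module k V']
  [AddCommGroup W] [Module k W] [AddCommGroup W'] [Module k W']
variable {B : Type*} [NonUnitalRing B] [Module k B] [SMulCommClass k B B] [IsScalarTower k B B]

theorem sliceLeft_lTensor (ε : V →ₗ[k] k) (f : W →ₗ[k] W') (u : V ⊗[k] W) :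
    sliceLeft ε W' (f.lTensor V u) = f (sliceLeft ε W u) := by
  induction u using TensorProduct.induction_on with
  | zero => simp
  | add x y hx hy => simp only [map_add, hx, hy]
  | tmul p q => simp

theorem sliceRight_rTensor (ε : V →ₗ[k] k) (f : W →ₗ[k] W') (u : W ⊗[k] V) :
    sliceRight W' ε (f.rTensor V u) = f (sliceRight W ε u) := by
  induction u using TensorProduct.induction_on with
  | zero => simp
  | add x y hx hy => simp only [map_add, hx, hy]
  | tmul p q => simp

theorem sliceRight_lTensor_mulRight {ε : B →ₗ[k] k} (hε : ∀ a b, ε (a * b) = ε a * ε b) (b : B)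
    (u : W ⊗[k] B) :
    sliceRight W ε ((LinearMap.mulRight k b).lTensor W u) = ε b • sliceRight W ε u := by
  induction u using TensorProduct.induction_on with
  | zero => simp
  | add x y hx hy => simp only [map_add, smul_add, hx, hy]
  | tmul p q => simp [hε, mul_comm (ε _) (ε b), mul_smul]

theorem sliceLeft_rTensor_mulLeft {ε : B →ₗ[k] k} (hε : ∀ a b, ε (a * b) = ε a * ε b) (b : B)
    (u : B ⊗[k] W) :
    sliceLeft ε W ((LinearMap.mulLeft k b).rTensor W u) = ε b • sliceLeft ε W u := by
  induction u using TensorProduct.induction_on with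
  | zero => simp
  | add x y hx hy => simp only [map_add, smul_add, hx, hy]
  | tmul p q => simp [hε, mul_smul]

theorem counit_sliceLeft (ε : V →ₗ[k] k) (η : W →ₗ[k] k) (u : V ⊗[k] W) :
    η (sliceLeft ε W u) = ε (sliceRight V η u) := by
  induction u using TensorProduct.induction_on with
  | zero => simp
  | add x y hx hy => simp only [map_add, hx, hy]
  | tmul p q => simp [mul_comm]

end Slices

/-! ### The remaining counit identities, and the antipode. -/

namespace RegularMultiplierHopf

variable {k : Type*} [Field k]
variable {A : Type*} [NonUnitalRing A] [Module k A] [SMulCommClass k A A] [IsScalarTower k A A]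
variable (H : RegularMultiplierHopf k A)

/-- Multiplying by 1 ⊗ c on the right turns T₂ into (a ⊗ 1)T₁(b ⊗ c), where the defining identity
applies and multiplicativity of ε pulls out ε(a). -/
theorem sliceLeft_counit_T₂ (a b : A) :
    sliceLeft H.counit A (H.T₂ (a ⊗ₜ b)) = H.counit a • b := by
  refine H.nondegenerate.eq_of_mul_right fun c => ?_
  have h := congrArg (sliceLeft H.counit A) (H.lTensor_mulRight_T₂ a b c)
  rw [sliceLeft_lTensor, sliceLeft_rTensor_mulLeft H.counit_mul, sliceLeft_counit_T₁] at h
  simpa [smul_mul_assoc] using h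

theorem sliceRight_counit_T₁ (b c : A) :
    sliceRight A H.counit (H.T₁ (b ⊗ₜ c)) = H.counit c • b := by
  refine H.nondegenerate.eq_of_mul_left fun a => ?_
  have h := congrArg (sliceRight A H.counit) (H.lTensor_mulRight_T₂ a b c)
  rw [sliceRight_rTensor, sliceRight_lTensor_mulRight H.counit_mul, sliceRight_counit_T₂] at h
  simpa [mul_smul_comm] using h.symm

/-- The antipode `S` and the map `Φ(x ⊗ v) = x S(v)`; the second property of `Φ` reads
`b₁ S(c b₂) = ε(b) S(c)`. -/
theorem exists_antipode [Nontrivial A] :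
    ∃ (S : A → A) (Φ : A ⊗[k] A →ₗ[k] A), Function.Surjective S ∧
      (∀ x v, Φ (x ⊗ₜ v) = x * S v) ∧ ∀ c b, Φ (H.T₄ (c ⊗ₜ b)) = H.counit b • S c := by
  obtain ⟨e, he⟩ := H.exists_counit_eq_one
  -- This choice is forced by the antipode identity a b₍₁₎S(b₍₂₎) = ε(b)a, which prescribes Φ on
  -- T₂(a ⊗ b).
  let Φ : A ⊗[k] A →ₗ[k] A := sliceRight A H.counit ∘ₗ H.T₂.symm.toLinearMap
  have hT₂ : ∀ w, Φ (H.T₂ w) = sliceRight A H.counit w := fun w => by simp [Φ]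
  have hΔ : ∀ b w, Φ ((H.Δ b).R w) = H.counit b • Φ w := by
    intro b w
    obtain ⟨w, rfl⟩ := H.T₂.surjective w
    induction w using TensorProduct.induction_on with
    | zero => simp
    | add x y hx hy => simp only [map_add, smul_add, hx, hy]
    | tmul c a =>
      rw [← T₂_tmul_mul, hT₂, hT₂, sliceRight_tmul, sliceRight_tmul, counit_mul, mul_comm, mul_smul]
  have hmul : ∀ x w, Φ ((LinearMap.mulLeft k x).rTensor A w) = x * Φ w := by
    intro x w
    obtain ⟨w, rfl⟩ := H.T₂.surjective w
    induction w using TensorProduct.induction_on with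
    | zero => simp
    | add x y hx hy => simp only [map_add, mul_add, hx, hy]
    | tmul c a =>
      rw [← T₂_mul_tmul, hT₂, hT₂, sliceRight_tmul, sliceRight_tmul, mul_smul_comm]
  have hT₄ : ∀ x c b, x * Φ (H.T₄ (c ⊗ₜ b)) = H.counit b • Φ (x ⊗ₜ c) := fun x c b => by
    rw [← hmul, ← Δ_R_tmul', hΔ]
  have hS : ∀ c b, Φ (H.T₄ (c ⊗ₜ b)) = H.counit b • Φ (H.T₄ (c ⊗ₜ e)) := fun c b =>
    H.nondegenerate.eq_of_mul_left fun x => by rw [mul_smul_comm, hT₄, hT₄, he, one_smul]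
  refine ⟨fun c => Φ (H.T₄ (c ⊗ₜ e)), Φ, fun a => ?_, fun x v => ?_, hS⟩
  -- Since Φ(T₂(a ⊗ e)) = a and Φ(T₄(w)) = S((ι ⊗ ε)(w)), surjectivity of T₄ provides a preimage of
  -- a under S.
  · obtain ⟨w, hw⟩ := H.T₄.surjective (H.T₂ (a ⊗ₜ e))
    refine ⟨sliceRight A H.counit w, ?_⟩
    have : ∀ w, Φ (H.T₄ (sliceRight A H.counit w ⊗ₜ e)) = Φ (H.T₄ w) := by
      intro w
      induction w using TensorProduct.induction_on with
      | zero => simp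
      | add x y hx hy => simp only [map_add, TensorProduct.add_tmul, hx, hy]
      | tmul c b => rw [hS c b, sliceRight_tmul, ← TensorProduct.smul_tmul', map_smul, map_smul]
    simp only [this, hw, hT₂, sliceRight_tmul, he, one_smul]
  · rw [hT₄, he, one_smul]

end RegularMultiplierHopf

/-! ### The maps T and Tb attached to ρ, their covers and their iterates. -/

section Coaction

variable {k : Type*} [Field k]
variable {A : Type*} [NonUnitalRing A] [Module k A] [SMulCommClass k A A] [IsScalarTower k A A]
variable {Y : Type*} [NonUnitalRing Y] [Module k Y] [SMulCommClass k Y Y] [IsScalarTower k Y Y]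
variable {HA : RegularMultiplierHopf k A} {HY : RegularMultiplierHopf k Y}
variable {ρ : Y →ₗ[k] Multiplier k (A ⊗[k] Y)}
variable {T T' : Y ⊗[k] A →ₗ[k] A ⊗[k] Y} {Tb : A ⊗[k] Y →ₗ[k] A ⊗[k] Y}

theorem IsT.L_tmul (hT : IsT ρ T) (hAY : Nondegenerate (A ⊗[k] Y)) (y : Y) (a : A) (y' : Y) :
    (ρ y).L (a ⊗ₜ y') = (LinearMap.mulRight k y').lTensor A (T (y ⊗ₜ a)) :=
  Multiplier.L_tmul_of_mul_left hAY (hT y a).symm y'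

theorem IsTbar.R_tmul (hTb : IsTbar ρ Tb) (hAY : Nondegenerate (A ⊗[k] Y)) (y : Y) (a : A)
    (y' : Y) : (ρ y).R (a ⊗ₜ y') = (LinearMap.mulLeft k y').lTensor A (Tb (a ⊗ₜ y)) :=
  Multiplier.R_tmul_of_mul_left hAY (hTb a y).symm y'

theorem IsT.unique (hT : IsT ρ T) (hT' : IsT ρ T') (hAY : Nondegenerate (A ⊗[k] Y)) : T = T' :=
  TensorProduct.ext' fun y a => toMult_injective (k := k) hAY (by rw [hT, hT'])

theorem IsT.rTensor_mulLeft (hT : IsT ρ T) (hTb : IsTbar ρ Tb) (hAY : Nondegenerate (A ⊗[k] Y))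
    (a : A) (y : Y) (a' : A) :
    (LinearMap.mulLeft k a).rTensor Y (T (y ⊗ₜ a')) =
      (LinearMap.mulRight k a').rTensor Y (Tb (a ⊗ₜ y)) := by
  apply toMult_injective (k := k) hAY
  have h₁ := mul_toMult hAY (multTmul (toMult k a) (1 : Multiplier k Y)) (T (y ⊗ₜ a'))
  have h₂ := toMult_mul hAY (multTmul (toMult k a') (1 : Multiplier k Y)) (Tb (a ⊗ₜ y))
  rw [multTmul_toMult_one_L] at h₁
  rw [multTmul_toMult_one_R] at h₂
  rw [← h₁, ← h₂, hT, hTb, mul_assoc]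

theorem IsT.tmul_mul (hT : IsT ρ T) (hAY : Nondegenerate (A ⊗[k] Y)) (y : Y) (a a' : A) :
    T (y ⊗ₜ (a * a')) = (LinearMap.mulRight k a').rTensor Y (T (y ⊗ₜ a)) := by
  apply toMult_injective (k := k) hAY
  have h₂ := toMult_mul hAY (multTmul (toMult k a') (1 : Multiplier k Y)) (T (y ⊗ₜ a))
  rw [multTmul_toMult_one_R] at h₂
  rw [← h₂, hT, hT, mul_assoc]
  congr 1
  refine Multiplier.ext_of_L_R (fun b => ?_) fun b => ?_ <;>
  · induction b using TensorProduct.induction_on with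
    | zero => simp
    | add x y hx hy => simp only [map_add, hx, hy]
    | tmul p q => simp [mul_assoc]

theorem IsT.sliceLeft_counit (hT : IsT ρ T) (hAY : Nondegenerate (A ⊗[k] Y))
    (hY : Nondegenerate Y) [Nontrivial A] {y : Y}
    (hy : ExtendsTo (toMult k ∘ₗ sliceLeft HA.counit Y) (ρ y) (toMult k y)) (a : A) :
    sliceLeft HA.counit Y (T (y ⊗ₜ a)) = HA.counit a • y := by
  refine hY.eq_of_mul_right fun y' => ?_
  have h := (hy (a ⊗ₜ y')).1
  rw [LinearMap.comp_apply, LinearMap.comp_apply, mul_toMult hY] at h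
  have h' := toMult_injective (k := k) hY h
  rw [hT.L_tmul hAY, sliceLeft_lTensor] at h'
  simpa [smul_mul_assoc] using h'.symm

/-- Cover the first leg by e with ε_Y(e) = 1: multiplicativity makes the cover invisible to ε_Y, and
(ε_Y ⊗ ι)((e ⊗ 1)Δ_Y(y)) = y. -/
theorem IsCoverRight.sliceLeft_counit [Nontrivial Y] {y : Y} {a : A} {y₁ : Y}
    {z : Y ⊗[k] (A ⊗[k] Y)} (hz : IsCoverRight HY T y a y₁ z) :
    sliceLeft HY.counit (A ⊗[k] Y) z = (LinearMap.mulRight k y₁).lTensor A (T (y ⊗ₜ a)) := by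
  obtain ⟨e, he⟩ := HY.exists_counit_eq_one
  have h := congrArg (sliceLeft HY.counit (A ⊗[k] Y)) (hz e).1
  have key : ∀ w : Y ⊗[k] Y, sliceLeft HY.counit (Y ⊗[k] A) (TensorProduct.assoc k Y Y A (w ⊗ₜ a)) =
      sliceLeft HY.counit Y w ⊗ₜ a := by
    intro w
    induction w using TensorProduct.induction_on with
    | zero => simp
    | add x y hx hy => simp only [map_add, TensorProduct.add_tmul, hx, hy]
    | tmul p q => simp [TensorProduct.smul_tmul']
  rw [sliceLeft_rTensor_mulLeft HY.counit_mul, he, one_smul, sliceLeft_lTensor, sliceLeft_lTensor,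
    key, HY.sliceLeft_counit_T₂, he, one_smul] at h
  exact h

theorem IsCoverBar.sliceRight_counit [Nontrivial Y] {a : A} {y y₁ : Y}
    {u : (A ⊗[k] Y) ⊗[k] Y} (hu : IsCoverBar HY Tb a y y₁ u) :
    sliceRight (A ⊗[k] Y) HY.counit u = (LinearMap.mulRight k y₁).lTensor A (Tb (a ⊗ₜ y)) := by
  obtain ⟨e, he⟩ := HY.exists_counit_eq_one
  have h := congrArg (sliceRight (A ⊗[k] Y) HY.counit) (hu e).1
  have key : ∀ w : Y ⊗[k] Y, sliceRight (A ⊗[k] Y) HY.counit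
      ((TensorProduct.assoc k A Y Y).symm (a ⊗ₜ w)) = a ⊗ₜ sliceRight Y HY.counit w := by
    intro w
    induction w using TensorProduct.induction_on with
    | zero => simp
    | add x y hx hy => simp only [map_add, TensorProduct.tmul_add, hx, hy]
    | tmul p q => simp
  rw [sliceRight_lTensor_mulRight HY.counit_mul, he, one_smul, sliceRight_rTensor,
    sliceRight_rTensor, key, HY.sliceRight_counit_T₁, he, one_smul] at h
  exact h

variable (T Tb) in
/-- `w ↦ (ι ⊗ T)(T ⊗ ι)(y ⊗ w)`. -/
def iterT (y : Y) : A ⊗[k] A →ₗ[k] (A ⊗[k] A) ⊗[k] Y :=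
  (TensorProduct.assoc k A A Y).symm.toLinearMap ∘ₗ T.lTensor A ∘ₗ
    (TensorProduct.assoc k A Y A).toLinearMap ∘ₗ T.rTensor A ∘ₗ
      (TensorProduct.assoc k Y A A).symm.toLinearMap ∘ₗ TensorProduct.mk k Y (A ⊗[k] A) y

variable (Tb) in
/-- `w ↦ (ι ⊗ Tb)(ι ⊗ τ)(Tb ⊗ ι)(ι ⊗ τ)(w ⊗ y)`. -/
def iterTbar (y : Y) : A ⊗[k] A →ₗ[k] (A ⊗[k] A) ⊗[k] Y :=
  (TensorProduct.assoc k A A Y).symm.toLinearMap ∘ₗ Tb.lTensor A ∘ₗ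
    (TensorProduct.comm k Y A).toLinearMap.lTensor A ∘ₗ
      (TensorProduct.assoc k A Y A).toLinearMap ∘ₗ Tb.rTensor A ∘ₗ
        (TensorProduct.assoc k A Y A).symm.toLinearMap ∘ₗ
          (TensorProduct.comm k A Y).toLinearMap.lTensor A ∘ₗ
            (TensorProduct.assoc k A A Y).toLinearMap ∘ₗ
              (TensorProduct.mk k (A ⊗[k] A) Y).flip y

theorem iterT_tmul (y : Y) (a b : A) :
    iterT T y (a ⊗ₜ b) = (TensorProduct.assoc k A A Y).symm
      ((T ∘ₗ (TensorProduct.mk k Y A).flip b).lTensor A (T (y ⊗ₜ a))) := by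
  simp only [iterT, LinearMap.comp_apply, TensorProduct.mk_apply, LinearEquiv.coe_coe,
    TensorProduct.assoc_symm_tmul, LinearMap.rTensor_tmul]
  congr 1
  induction T (y ⊗ₜ a) using TensorProduct.induction_on with
  | zero => simp
  | add x y hx hy => simp only [map_add, TensorProduct.add_tmul, hx, hy]
  | tmul p q => simp

theorem iterTbar_tmul (y : Y) (a b : A) :
    iterTbar Tb y (a ⊗ₜ b) = (TensorProduct.assoc k A A Y).symm
      ((Tb ∘ₗ TensorProduct.mk k A Y b).lTensor A (Tb (a ⊗ₜ y))) := by
  simp only [iterTbar, LinearMap.comp_apply, TensorProduct.mk_apply, LinearEquiv.coe_coe,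
    TensorProduct.assoc_symm_tmul, LinearMap.rTensor_tmul, LinearMap.flip_apply,
    TensorProduct.assoc_tmul, LinearMap.lTensor_tmul, TensorProduct.comm_tmul]
  congr 1
  induction Tb (a ⊗ₜ y) using TensorProduct.induction_on with
  | zero => simp
  | add x y hx hy => simp only [map_add, TensorProduct.add_tmul, hx, hy]
  | tmul p q => simp

end Coaction

/-! ### Building a multiplier of B ⊗ C from its covers in B. -/

section MultiplierConstruction

variable {k : Type*} [Field k]
variable {B : Type*} [NonUnitalRing B] [Module k B] [SMulCommClass k B B] [IsScalarTower k B B]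
variable {C : Type*} [NonUnitalRing C] [Module k C] [SMulCommClass k C C] [IsScalarTower k C C]

/-- A multiplier `n` of `B ⊗ C` is given by compatible maps `g(b) = n (b ⊗ 1)` and
`h(b) = (b ⊗ 1) n` with values in `B ⊗ C`. -/
theorem exists_multiplier (hB : Nondegenerate B) (hC : Nondegenerate C) (g h : B →ₗ[k] B ⊗[k] C)
    (hgh : ∀ b b', (LinearMap.mulLeft k b).rTensor C (g b') =
      (LinearMap.mulRight k b').rTensor C (h b)) :
    ∃ n : Multiplier k (B ⊗[k] C), ∀ b,
      n * multTmul (toMult k b) 1 = toMult k (g b) ∧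
      multTmul (toMult k b) 1 * n = toMult k (h b) := by
  have hBC : Nondegenerate (B ⊗[k] C) := hB.tensorProduct hC
  -- The compatibility `hgh` alone forces g to be right B-linear and h left B-linear, by
  -- nondegeneracy of B.
  have hg : ∀ b b', g (b * b') = (LinearMap.mulRight k b').rTensor C (g b) := fun b b' =>
    hB.eq_of_rTensor_mulLeft fun x => by
      rw [hgh, LinearMap.mulRight_mul, LinearMap.rTensor_comp, LinearMap.comp_apply, ← hgh,
        ← LinearMap.rTensor_comp_apply, ← LinearMap.rTensor_comp_apply]
      congr 2
      ext y
      simp [mul_assoc]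
  have hh : ∀ b b', h (b * b') = (LinearMap.mulLeft k b).rTensor C (h b') := fun b b' =>
    hB.eq_of_rTensor_mulRight fun x => by
      rw [← hgh, LinearMap.mulLeft_mul, LinearMap.rTensor_comp, LinearMap.comp_apply, hgh,
        ← LinearMap.rTensor_comp_apply, ← LinearMap.rTensor_comp_apply]
      congr 2
      ext y
      simp [mul_assoc]
  let NL : B ⊗[k] C →ₗ[k] B ⊗[k] C := (LinearMap.mul' k C).lTensor B ∘ₗ
    (TensorProduct.assoc k B C C).toLinearMap ∘ₗ g.rTensor C
  let NR : B ⊗[k] C →ₗ[k] B ⊗[k] C := (LinearMap.mul' k C ∘ₗ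
    (TensorProduct.comm k C C).toLinearMap).lTensor B ∘ₗ
      (TensorProduct.assoc k B C C).toLinearMap ∘ₗ h.rTensor C
  have hNL : ∀ b c, NL (b ⊗ₜ c) = (LinearMap.mulRight k c).lTensor B (g b) := by
    intro b c
    simp only [NL, LinearMap.comp_apply, LinearMap.rTensor_tmul, LinearEquiv.coe_coe]
    induction g b using TensorProduct.induction_on with
    | zero => simp
    | add x y hx hy => simp only [map_add, TensorProduct.add_tmul, hx, hy]
    | tmul p q => simp
  have hNR : ∀ b c, NR (b ⊗ₜ c) = (LinearMap.mulLeft k c).lTensor B (h b) := by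
    intro b c
    simp only [NR, LinearMap.comp_apply, LinearMap.rTensor_tmul, LinearEquiv.coe_coe]
    induction h b using TensorProduct.induction_on with
    | zero => simp
    | add x y hx hy => simp only [map_add, TensorProduct.add_tmul, hx, hy]
    | tmul p q => simp
  have hcentral : ∀ u v, u * NL v = NR u * v := by
    intro u v
    induction u using TensorProduct.induction_on with
    | zero => simp
    | add x y hx hy => simp only [add_mul, map_add, hx, hy]
    | tmul b c =>
      induction v using TensorProduct.induction_on with
      | zero => simp
      | add x y hx hy => simp only [mul_add, map_add, hx, hy]
      | tmul b' c' =>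
        rw [hNL, hNR, mul_tmul_eq, mul_lTensor_mulRight, tmul_mul_eq, ← lTensor_rTensor_comm, hgh,
          ← lTensor_rTensor_comm, ← lTensor_rTensor_comm]
  refine ⟨⟨(NL, MulOpposite.op NR), hcentral⟩, fun b => ⟨?_, ?_⟩⟩
  · refine Multiplier.ext_of_L hBC fun u => ?_
    change NL ((LinearMap.mulLeft k b).rTensor C u) = g b * u
    induction u using TensorProduct.induction_on with
    | zero => simp
    | add x y hx hy => simp only [mul_add, map_add, hx, hy]
    | tmul b' c' =>
      rw [LinearMap.rTensor_tmul, hNL, LinearMap.mulLeft_apply, hg, mul_tmul_eq,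
        lTensor_rTensor_comm]
  · refine Multiplier.ext_of_R hBC fun u => ?_
    change NR ((LinearMap.mulRight k b).rTensor C u) = u * h b
    induction u using TensorProduct.induction_on with
    | zero => simp
    | add x y hx hy => simp only [add_mul, map_add, hx, hy]
    | tmul b' c' =>
      rw [LinearMap.rTensor_tmul, hNR, LinearMap.mulRight_apply, hh, tmul_mul_eq,
        lTensor_rTensor_comm]

theorem multTmul_mul_multTmul (m m' : Multiplier k B) (n n' : Multiplier k C) :
    multTmul m n * multTmul m' n' = multTmul (m * m') (n * n') := by
  refine Multiplier.ext_of_L_R (fun b => ?_) fun b => ?_ <;>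
  · induction b using TensorProduct.induction_on with
    | zero => simp
    | add x y hx hy => simp only [map_add, hx, hy]
    | tmul p q => simp

theorem multTmul_toMult (b : B) (c : C) :
    multTmul (toMult k b) (toMult k c) = toMult k (b ⊗ₜ[k] c) := by
  refine Multiplier.ext_of_L_R (fun u => ?_) fun u => ?_ <;>
  · induction u using TensorProduct.induction_on with
    | zero => simp
    | add x y hx hy => simp only [map_add, hx, hy]
    | tmul p q => simp

end MultiplierConstruction

/-! ### Covering the middle leg, and the multiplier (ι ⊗ ρ)ρ(y). -/

section Cover

variable {k : Type*} [Field k]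
variable {A : Type*} [NonUnitalRing A] [Module k A] [SMulCommClass k A A] [IsScalarTower k A A]
variable {Y : Type*} [NonUnitalRing Y] [Module k Y] [SMulCommClass k Y Y] [IsScalarTower k Y Y]

/-- The multiplier `1 ⊗ a ⊗ 1` of `A ⊗ A ⊗ Y`. -/
def midMult (Y : Type*) [NonUnitalRing Y] [Module k Y] [SMulCommClass k Y Y]
    [IsScalarTower k Y Y] (a : A) : Multiplier k ((A ⊗[k] A) ⊗[k] Y) :=
  multTmul (multTmul 1 (toMult k a)) 1

theorem eq_of_mul_midMult (hA : Nondegenerate A) (hY : Nondegenerate Y)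
    {m m' : Multiplier k ((A ⊗[k] A) ⊗[k] Y)}
    (h : ∀ a, m * midMult Y a = m' * midMult Y a) : m = m' := by
  refine Multiplier.ext_of_R ((hA.tensorProduct hA).tensorProduct hY) fun u => ?_
  refine eq_of_forall_rTensor_eq (ι := A) (fun a => (LinearMap.mulRight k a).lTensor A)
    (fun v hv => hA.eq_of_lTensor_mulRight fun a => by rw [hv a, map_zero]) fun a => ?_
  exact congrArg (fun n => Multiplier.R n u) (h a)

theorem eq_of_midMult_mul (hA : Nondegenerate A) (hY : Nondegenerate Y)
    {m m' : Multiplier k ((A ⊗[k] A) ⊗[k] Y)}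
    (h : ∀ a, midMult Y a * m = midMult Y a * m') : m = m' := by
  refine Multiplier.ext_of_L ((hA.tensorProduct hA).tensorProduct hY) fun u => ?_
  refine eq_of_forall_rTensor_eq (ι := A) (fun a => (LinearMap.mulLeft k a).lTensor A)
    (fun v hv => hA.eq_of_lTensor_mulLeft fun a => by rw [hv a, map_zero]) fun a => ?_
  exact congrArg (fun n => Multiplier.L n u) (h a)

variable (HA : RegularMultiplierHopf k A)

theorem comulTensorId_tmul (a : A) (y : Y) :
    comulTensorId HA Y (a ⊗ₜ y) = multTmul (HA.Δ a) (toMult k y) := rfl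

theorem comulTensorId_mul_midMult (w : A ⊗[k] Y) (a : A) :
    comulTensorId HA Y w * midMult Y a =
      toMult k ((HA.T₁.toLinearMap ∘ₗ (TensorProduct.mk k A A).flip a).rTensor Y w) := by
  induction w using TensorProduct.induction_on with
  | zero => simp
  | add x y hx hy => simp only [map_add, add_mul, hx, hy]
  | tmul b y =>
    rw [comulTensorId_tmul, midMult, multTmul_mul_multTmul, ← HA.T₁_spec, mul_one,
      multTmul_toMult]
    rfl

theorem midMult_mul_comulTensorId (w : A ⊗[k] Y) (a : A) :
    midMult Y a * comulTensorId HA Y w =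
      toMult k ((HA.T₄.toLinearMap ∘ₗ TensorProduct.mk k A A a).rTensor Y w) := by
  induction w using TensorProduct.induction_on with
  | zero => simp
  | add x y hx hy => simp only [map_add, mul_add, hx, hy]
  | tmul b y =>
    rw [comulTensorId_tmul, midMult, multTmul_mul_multTmul, ← HA.T₄_spec, one_mul,
      multTmul_toMult]
    rfl

variable {HA} {HY : RegularMultiplierHopf k Y}
variable {ρ : Y →ₗ[k] Multiplier k (A ⊗[k] Y)}
variable {T : Y ⊗[k] A →ₗ[k] A ⊗[k] Y} {Tb : A ⊗[k] Y →ₗ[k] A ⊗[k] Y}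

/-- Both sides stand for (w ⊗ 1)·(ι ⊗ ρ)ρ(y)·(w' ⊗ 1): on simple tensors `IsT.rTensor_mulLeft` is
used once for each leg. This is the compatibility required by `exists_multiplier`. -/
theorem iterT_compat (hT : IsT ρ T) (hTb : IsTbar ρ Tb) (hAY : Nondegenerate (A ⊗[k] Y)) (y : Y)
    (w w' : A ⊗[k] A) :
    (LinearMap.mulLeft k w).rTensor Y (iterT T y w') =
      (LinearMap.mulRight k w').rTensor Y (iterTbar Tb y w) := by
  induction w using TensorProduct.induction_on with
  | zero => simp
  | add x x' hx hx' =>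
    rw [map_add, map_add, ← hx, ← hx', ← LinearMap.add_apply, ← LinearMap.rTensor_add]
    congr 2
    ext; simp [add_mul]
  | tmul a b =>
  induction w' using TensorProduct.induction_on with
  | zero => simp
  | add x x' hx hx' =>
    rw [map_add, map_add, hx, hx', ← LinearMap.add_apply, ← LinearMap.rTensor_add]
    congr 2
    ext; simp [mul_add]
  | tmul a' b' =>
  rw [iterT_tmul, iterTbar_tmul]
  have key₁ : ∀ (f : Y →ₗ[k] A ⊗[k] Y) (u : A ⊗[k] Y),
      (LinearMap.mulLeft k (a ⊗ₜ[k] b)).rTensor Y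
        ((TensorProduct.assoc k A A Y).symm (f.lTensor A u)) =
      (TensorProduct.assoc k A A Y).symm (((LinearMap.mulLeft k b).rTensor Y ∘ₗ f).lTensor A
        ((LinearMap.mulLeft k a).rTensor Y u)) := by
    intro f u
    induction u using TensorProduct.induction_on with
    | zero => simp
    | add x y hx hy => simp only [map_add, hx, hy]
    | tmul p t =>
      simp only [LinearMap.lTensor_tmul, LinearMap.rTensor_tmul, LinearMap.comp_apply]
      induction f t using TensorProduct.induction_on with
      | zero => simp
      | add x y hx hy => simp only [map_add, TensorProduct.tmul_add, hx, hy]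
      | tmul q s => simp
  have key₂ : ∀ (f : Y →ₗ[k] A ⊗[k] Y) (u : A ⊗[k] Y),
      (LinearMap.mulRight k (a' ⊗ₜ[k] b')).rTensor Y
        ((TensorProduct.assoc k A A Y).symm (f.lTensor A u)) =
      (TensorProduct.assoc k A A Y).symm (((LinearMap.mulRight k b').rTensor Y ∘ₗ f).lTensor A
        ((LinearMap.mulRight k a').rTensor Y u)) := by
    intro f u
    induction u using TensorProduct.induction_on with
    | zero => simp
    | add x y hx hy => simp only [map_add, hx, hy]
    | tmul p t =>
      simp only [LinearMap.lTensor_tmul, LinearMap.rTensor_tmul, LinearMap.comp_apply]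
      induction f t using TensorProduct.induction_on with
      | zero => simp
      | add x y hx hy => simp only [map_add, TensorProduct.tmul_add, hx, hy]
      | tmul q s => simp
  rw [key₁, key₂, hT.rTensor_mulLeft hTb hAY]
  congr 3
  ext t
  exact hT.rTensor_mulLeft hTb hAY b t b'

theorem exists_isIteratedCoaction (hA : Nondegenerate A) (hY : Nondegenerate Y)
    (hT : IsT ρ T) (hTb : IsTbar ρ Tb) (y : Y) : ∃ n, IsIteratedCoaction T Tb y n ∧
      (∀ w y', n.L (w ⊗ₜ y') = (LinearMap.mulRight k y').lTensor _ (iterT T y w)) ∧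
      ∀ w y', n.R (w ⊗ₜ y') = (LinearMap.mulLeft k y').lTensor _ (iterTbar Tb y w) := by
  obtain ⟨n, hn⟩ := exists_multiplier (hA.tensorProduct (k := k) hA) hY (iterT T y)
    (iterTbar Tb y) (iterT_compat hT hTb (hA.tensorProduct hY) y)
  have hAAY : Nondegenerate ((A ⊗[k] A) ⊗[k] Y) := (hA.tensorProduct hA).tensorProduct hY
  refine ⟨n, fun a b => ?_, fun w y' => Multiplier.L_tmul_of_mul_left hAAY (hn w).1 y',
    fun w y' => Multiplier.R_tmul_of_mul_left hAAY (hn w).2 y'⟩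
  rw [← iterT_tmul, ← iterTbar_tmul]
  exact hn _

theorem IsIteratedCoaction.L_tmul (hA : Nondegenerate A) (hY : Nondegenerate Y) {y : Y}
    {n : Multiplier k ((A ⊗[k] A) ⊗[k] Y)} (hn : IsIteratedCoaction T Tb y n) (w : A ⊗[k] A)
    (y' : Y) : n.L (w ⊗ₜ y') = (LinearMap.mulRight k y').lTensor _ (iterT T y w) := by
  induction w using TensorProduct.induction_on with
  | zero => simp
  | add x y hx hy => simp only [map_add, TensorProduct.add_tmul, hx, hy]
  | tmul a b =>
    rw [iterT_tmul]
    exact Multiplier.L_tmul_of_mul_left ((hA.tensorProduct hA).tensorProduct hY) (hn a b).1 y'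

end Cover

/-! ### The counit condition against coassociativity. -/

section Characterization

variable {k : Type*} [Field k]
variable {A : Type*} [NonUnitalRing A] [Module k A] [SMulCommClass k A A] [IsScalarTower k A A]
variable {Y : Type*} [NonUnitalRing Y] [Module k Y] [SMulCommClass k Y Y] [IsScalarTower k Y Y]
variable {HA : RegularMultiplierHopf k A} {HY : RegularMultiplierHopf k Y}
variable {ρ : Y →ₗ[k] Multiplier k (A ⊗[k] Y)}
variable {T : Y ⊗[k] A →ₗ[k] A ⊗[k] Y} {Tb : A ⊗[k] Y →ₗ[k] A ⊗[k] Y}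

variable (HA HY T) in
/-- The right-hand side of the equation of partial coassociativity. -/
def coassocRight (a₁ : A) : Y ⊗[k] (A ⊗[k] Y) →ₗ[k] A ⊗[k] (A ⊗[k] Y) :=
  (sliceRight A HY.counit ∘ₗ T).rTensor (A ⊗[k] Y) ∘ₗ
    (TensorProduct.assoc k Y A (A ⊗[k] Y)).symm.toLinearMap ∘ₗ
      (TensorProduct.assoc k A A Y).toLinearMap.lTensor Y ∘ₗ
        ((HA.T₁.toLinearMap ∘ₗ (TensorProduct.mk k A A).flip a₁).rTensor Y).lTensor Y

theorem assoc_lTensor (g : Y →ₗ[k] Y) (u : (A ⊗[k] A) ⊗[k] Y) :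
    (g.lTensor A).lTensor A (TensorProduct.assoc k A A Y u) =
      TensorProduct.assoc k A A Y (g.lTensor (A ⊗[k] A) u) := by
  induction u using TensorProduct.induction_on with
  | zero => simp
  | add x y hx hy => simp only [map_add, hx, hy]
  | tmul w t =>
  induction w using TensorProduct.induction_on with
  | zero => simp
  | add x y hx hy => simp only [map_add, TensorProduct.add_tmul, hx, hy]
  | tmul p q => simp

theorem PartialCoassoc.iterT_eq (h : PartialCoassoc HA HY T) {y : Y} {a : A} (a₁ : A) {y₁ : Y}
    {z : Y ⊗[k] (A ⊗[k] Y)} (hz : IsCoverRight HY T y a y₁ z) :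
    TensorProduct.assoc k A A Y
      ((LinearMap.mulRight k y₁).lTensor _ (iterT T y (HA.T₁ (a ⊗ₜ a₁)))) =
        coassocRight HA HY T a₁ z := by
  rw [← assoc_lTensor]
  simpa [iterT, coassocRight] using h y a a₁ y₁ z hz

/-- Under `hθ` the first leg of z is seen only through ε_Y, so the extra leg of partial
coassociativity disappears. -/
theorem coassocRight_of_counit (hθ : ∀ y a, sliceRight A HY.counit (T (y ⊗ₜ a)) = HY.counit y • a)
    (a₁ : A) (z : Y ⊗[k] (A ⊗[k] Y)) :
    coassocRight HA HY T a₁ z = TensorProduct.assoc k A A Y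
      ((HA.T₁.toLinearMap ∘ₗ (TensorProduct.mk k A A).flip a₁).rTensor Y
        (sliceLeft HY.counit (A ⊗[k] Y) z)) := by
  induction z using TensorProduct.induction_on with
  | zero => simp
  | add x y hx hy => simp only [map_add, hx, hy]
  | tmul r w =>
  induction w using TensorProduct.induction_on with
  | zero => simp
  | add x y hx hy => simp only [map_add, TensorProduct.tmul_add, hx, hy]
  | tmul s t =>
    simp only [coassocRight, LinearMap.comp_apply, LinearMap.lTensor_tmul, LinearMap.rTensor_tmul,
      LinearEquiv.coe_coe, LinearMap.flip_apply, TensorProduct.mk_apply, sliceLeft_tmul, map_smul]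
    induction HA.T₁ (s ⊗ₜ a₁) using TensorProduct.induction_on with
    | zero => simp
    | add x y hx hy => simp only [map_add, TensorProduct.tmul_add, TensorProduct.add_tmul,
        smul_add, hx, hy]
    | tmul p q => simp [hθ, TensorProduct.smul_tmul']

/-- Under `hθ` the right side of the symmetric axiom sees the last leg of u only through ε_Y. Covers
exist for every y₁, so nondegeneracy of Y removes y₁. -/
theorem PartialCoassocBar.iterTbar_eq [Nontrivial Y] (h : PartialCoassocBar HA HY Tb)
    (hu : ∀ (a : A) (y y₁ : Y), ∃ u : (A ⊗[k] Y) ⊗[k] Y, IsCoverBar HY Tb a y y₁ u)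
    (hθ : ∀ a y, sliceRight A HY.counit (Tb (a ⊗ₜ y)) = HY.counit y • a) (a a₁ : A) (y : Y) :
    iterTbar Tb y (HA.T₄ (a₁ ⊗ₜ a)) =
      (HA.T₄.toLinearMap ∘ₗ TensorProduct.mk k A A a₁).rTensor Y (Tb (a ⊗ₜ y)) := by
  refine HY.nondegenerate.eq_of_lTensor_mulRight fun y₁ => ?_
  obtain ⟨u, hu⟩ := hu a y y₁
  apply (TensorProduct.assoc k A A Y).injective
  rw [lTensor_rTensor_comm, ← hu.sliceRight_counit, ← assoc_lTensor]
  refine Eq.trans ?_ ((h a a₁ y y₁ u hu).trans ?_)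
  · simp [iterTbar]
  clear hu
  induction u using TensorProduct.induction_on with
  | zero => simp
  | add x y hx hy => simp only [map_add, hx, hy]
  | tmul w r =>
  induction w using TensorProduct.induction_on with
  | zero => simp
  | add x y hx hy => simp only [map_add, TensorProduct.add_tmul, hx, hy]
  | tmul s t =>
    simp only [LinearMap.comp_apply, LinearMap.rTensor_tmul, LinearEquiv.coe_coe,
      TensorProduct.mk_apply, sliceRight_tmul, map_smul]
    induction HA.T₄ (a₁ ⊗ₜ s) using TensorProduct.induction_on with
    | zero => simp
    | add x y hx hy => simp only [map_add, TensorProduct.add_tmul, smul_add, hx, hy]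
    | tmul p q => simp [hθ, TensorProduct.smul_tmul']

theorem injective_of_counit [Nontrivial A] (hY : Nondegenerate Y)
    (hc : ∀ y : Y, ExtendsTo (toMult k ∘ₗ sliceLeft HA.counit Y) (ρ y) (toMult k y)) :
    Function.Injective ρ := by
  obtain ⟨e, he⟩ := HA.exists_counit_eq_one
  rw [injective_iff_map_eq_zero]
  refine fun y hy => hY.1 y fun b => ?_
  have h := (hc y (e ⊗ₜ b)).1
  rw [LinearMap.comp_apply, mul_toMult hY, hy] at h
  have h' := toMult_injective (k := k) hY
    (h.trans (show _ = toMult k (0 : Y) by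
      rw [show (0 : Multiplier k (A ⊗[k] Y)).L = 0 from rfl]; simp))
  simpa [he] using h'

/-- The two halves of `ExtendsTo` are tested against 1 ⊗ a₁ ⊗ 1 on the right and on the left. There
Δ_A becomes T₁ and T₄ respectively, and the claims reduce to `h₁` and `h₂`. -/
theorem extendsTo_comulTensorId (hT : IsT ρ T) (hTb : IsTbar ρ Tb) {y : Y}
    {n : Multiplier k ((A ⊗[k] A) ⊗[k] Y)}
    (hL : ∀ w y', n.L (w ⊗ₜ y') = (LinearMap.mulRight k y').lTensor _ (iterT T y w))
    (hR : ∀ w y', n.R (w ⊗ₜ y') = (LinearMap.mulLeft k y').lTensor _ (iterTbar Tb y w))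
    (h₁ : ∀ a a₁ y₁, (LinearMap.mulRight k y₁).lTensor _ (iterT T y (HA.T₁ (a ⊗ₜ a₁))) =
      (HA.T₁.toLinearMap ∘ₗ (TensorProduct.mk k A A).flip a₁).rTensor Y
        ((LinearMap.mulRight k y₁).lTensor A (T (y ⊗ₜ a))))
    (h₂ : ∀ a a₁, iterTbar Tb y (HA.T₄ (a₁ ⊗ₜ a)) =
      (HA.T₄.toLinearMap ∘ₗ TensorProduct.mk k A A a₁).rTensor Y (Tb (a ⊗ₜ y)))
    (hY : Nondegenerate Y) :
    ExtendsTo (comulTensorId HA Y) (ρ y) n := by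
  have hA := HA.nondegenerate
  have hAAY : Nondegenerate ((A ⊗[k] A) ⊗[k] Y) := (hA.tensorProduct hA).tensorProduct hY
  intro b
  constructor
  · refine eq_of_mul_midMult hA hY fun a₁ => ?_
    rw [mul_assoc, comulTensorId_mul_midMult, comulTensorId_mul_midMult, mul_toMult hAAY]
    congr 1
    induction b using TensorProduct.induction_on with
    | zero => simp
    | add x y hx hy => simp only [map_add, hx, hy]
    | tmul a y₁ =>
      rw [hT.L_tmul (hA.tensorProduct hY), ← h₁, ← hL]
      rfl
  · refine eq_of_midMult_mul hA hY fun a₁ => ?_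
    rw [← mul_assoc, midMult_mul_comulTensorId, midMult_mul_comulTensorId, toMult_mul hAAY]
    congr 1
    induction b using TensorProduct.induction_on with
    | zero => simp
    | add x y hx hy => simp only [map_add, hx, hy]
    | tmul a y₁ =>
      rw [hTb.R_tmul (hA.tensorProduct hY), ← lTensor_rTensor_comm, ← h₂, ← hR]
      rfl

theorem IsTbar.sliceRight_counit (hT : IsT ρ T) (hTb : IsTbar ρ Tb) (hA : Nondegenerate A) {y : Y}
    (h : ∀ a, sliceRight A HY.counit (T (y ⊗ₜ a)) = HY.counit y • a) (a : A) :
    sliceRight A HY.counit (Tb (a ⊗ₜ y)) = HY.counit y • a := by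
  refine hA.eq_of_mul_right fun a' => ?_
  have := congrArg (sliceRight A HY.counit)
    (hT.rTensor_mulLeft hTb (hA.tensorProduct HY.nondegenerate) a y a')
  rw [sliceRight_rTensor, sliceRight_rTensor, h] at this
  simpa [smul_mul_assoc, mul_smul_comm] using this.symm

/-- A cover of the Y-leg contributes only its counit, since ε_Y is multiplicative; an element of
counit 1 removes it. The left half of the extension follows from the right half through
`IsTbar.sliceRight_counit`. -/
theorem counitCondition_iff (hT : IsT ρ T) (hTb : IsTbar ρ Tb) (hA : Nondegenerate A)
    [Nontrivial Y] (y : Y) : CounitCondition HY ρ y ↔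
      ∀ a, sliceRight A HY.counit (T (y ⊗ₜ a)) = HY.counit y • a := by
  have hAY := hA.tensorProduct (k := k) HY.nondegenerate
  constructor
  · intro h a
    obtain ⟨e, he⟩ := HY.exists_counit_eq_one
    have h' := (h (a ⊗ₜ e)).1
    rw [LinearMap.comp_apply, LinearMap.comp_apply, mul_toMult hA] at h'
    have h'' := toMult_injective (k := k) hA h'
    rw [hT.L_tmul hAY, sliceRight_lTensor_mulRight HY.counit_mul, sliceRight_tmul, he, one_smul,
      one_smul] at h''
    exact h''.symm
  · intro h b
    have hb := hTb.sliceRight_counit hT hA h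
    rw [LinearMap.comp_apply, LinearMap.comp_apply, LinearMap.comp_apply, mul_toMult hA,
      toMult_mul hA]
    refine ⟨congrArg (toMult k) ?_, congrArg (toMult k) ?_⟩
    · induction b using TensorProduct.induction_on with
      | zero => simp
      | add x y hx hy => simp only [map_add, hx, hy]
      | tmul a y₁ =>
        rw [hT.L_tmul hAY, sliceRight_lTensor_mulRight HY.counit_mul, h, sliceRight_tmul, map_smul]
        rfl
    · induction b using TensorProduct.induction_on with
      | zero => simp
      | add x y hx hy => simp only [map_add, hx, hy]
      | tmul a y₁ =>
        rw [hTb.R_tmul hAY, RegularMultiplierHopf.sliceRight_lTensor_mulLeft HY.counit_mul, hb,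
          sliceRight_tmul, map_smul]
        rfl

/-- `(ι ⊗ ε_A ⊗ ε_Y)` of a cover of `(ι ⊗ T)(Δ(y) ⊗ a)(1 ⊗ 1 ⊗ y₁)`. -/
theorem IsCoverRight.sliceRight_counit {y : Y} {a : A} {y₁ : Y} {z : Y ⊗[k] (A ⊗[k] Y)}
    (hz : IsCoverRight HY T y a y₁ z)
    (hT : ∀ y a, sliceLeft HA.counit Y (T (y ⊗ₜ a)) = HA.counit a • y) :
    sliceRight Y (HY.counit ∘ₗ sliceLeft HA.counit Y) z = (HA.counit a * HY.counit y₁) • y := by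
  refine HY.nondegenerate.eq_of_mul_left fun y₂ => ?_
  -- After the slice, T contributes only ε_A(a), and what is left is (ι ⊗ ε_Y)T₂(y₂ ⊗ y) = y₂y.
  have h := congrArg (sliceRight Y (HY.counit ∘ₗ sliceLeft HA.counit Y)) (hz y₂).1
  rw [sliceRight_rTensor, LinearMap.mulLeft_apply] at h
  rw [h, mul_smul_comm, ← HY.sliceRight_counit_T₂]
  induction HY.T₂ (y₂ ⊗ₜ y) using TensorProduct.induction_on with
  | zero => simp
  | add x y hx hy => simp only [map_add, TensorProduct.add_tmul, smul_add, hx, hy]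
  | tmul p q =>
    simp only [TensorProduct.assoc_tmul, LinearMap.lTensor_tmul, sliceRight_tmul,
      LinearMap.comp_apply, sliceLeft_lTensor, hT, LinearMap.mulRight_apply, map_smul,
      HY.counit_mul, smul_smul, smul_eq_mul]
    congr 1
    ring

/-- `(ι ⊗ ι ⊗ ε_Y)` of the right-hand side of partial coassociativity. -/
theorem sliceRight_coassocRight (a₁ : A) (z : Y ⊗[k] (A ⊗[k] Y)) :
    (sliceRight A HY.counit).lTensor A (coassocRight HA HY T a₁ z) =
      (sliceRight A HY.counit ∘ₗ T).rTensor A ((TensorProduct.assoc k Y A A).symm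
        ((HA.T₁.toLinearMap ∘ₗ (TensorProduct.mk k A A).flip a₁).lTensor Y
          ((sliceRight A HY.counit).lTensor Y z))) := by
  induction z using TensorProduct.induction_on with
  | zero => simp
  | add x y hx hy => simp only [map_add, hx, hy]
  | tmul r w =>
  induction w using TensorProduct.induction_on with
  | zero => simp
  | add x y hx hy => simp only [map_add, TensorProduct.tmul_add, hx, hy]
  | tmul s t =>
    simp only [coassocRight, LinearMap.comp_apply, LinearMap.lTensor_tmul, LinearMap.rTensor_tmul,
      LinearEquiv.coe_coe, LinearMap.flip_apply, TensorProduct.mk_apply, sliceRight_tmul, map_smul,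
      TensorProduct.tmul_smul]
    induction HA.T₁ (s ⊗ₜ a₁) using TensorProduct.induction_on with
    | zero => simp
    | add x y hx hy => simp only [map_add, TensorProduct.tmul_add, TensorProduct.add_tmul,
        smul_add, hx, hy]
    | tmul p q => simp

theorem lTensor_assoc_symm {V W : Type*} [AddCommGroup V] [Module k V] [AddCommGroup W] [Module k W]
    (g : W →ₗ[k] W) (u : V ⊗[k] (A ⊗[k] W)) :
    g.lTensor (V ⊗[k] A) ((TensorProduct.assoc k V A W).symm u) =
      (TensorProduct.assoc k V A W).symm ((g.lTensor A).lTensor V u) := by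
  induction u using TensorProduct.induction_on with
  | zero => simp
  | add x y hx hy => simp only [map_add, hx, hy]
  | tmul t w =>
  induction w using TensorProduct.induction_on with
  | zero => simp
  | add x y hx hy => simp only [map_add, TensorProduct.tmul_add, hx, hy]
  | tmul p q => simp

theorem sliceRight_assoc {V W : Type*} [AddCommGroup V] [Module k V] [AddCommGroup W] [Module k W]
    (η : W →ₗ[k] k) (u : (V ⊗[k] A) ⊗[k] W) :
    (sliceRight A η).lTensor V (TensorProduct.assoc k V A W u) = sliceRight (V ⊗[k] A) η u := by
  induction u using TensorProduct.induction_on with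
  | zero => simp
  | add x y hx hy => simp only [map_add, hx, hy]
  | tmul w t =>
  induction w using TensorProduct.induction_on with
  | zero => simp
  | add x y hx hy => simp only [map_add, TensorProduct.add_tmul, hx, hy]
  | tmul p q => simp

/-- An identity `(θ ⊗ ι)(ι ⊗ Δ)(z) = Δ(b)` covered by `1 ⊗ a₁` on the right holds when covered by
`1 ⊗ c` on the left. -/
theorem RegularMultiplierHopf.rTensor_T₄_eq (H : RegularMultiplierHopf k A)
    {V : Type*} [AddCommGroup V] [Module k V] {θ : V ⊗[k] A →ₗ[k] A} {z : V ⊗[k] A} {b : A}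
    (h : ∀ a₁, θ.rTensor A ((TensorProduct.assoc k V A A).symm
      ((H.T₁.toLinearMap ∘ₗ (TensorProduct.mk k A A).flip a₁).lTensor V z)) = H.T₁ (b ⊗ₜ a₁))
    (c : A) :
    θ.rTensor A ((TensorProduct.assoc k V A A).symm
      ((H.T₄.toLinearMap ∘ₗ TensorProduct.mk k A A c).lTensor V z)) = H.T₄ (c ⊗ₜ b) := by
  refine H.nondegenerate.eq_of_lTensor_mulRight (k := k) fun a₁ => ?_
  -- The covers act on the last leg and θ on the others, so they commute. Covering additionally by 1
  -- ⊗ a₁ on the right turns T₄ into T₁.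
  have key : (LinearMap.mulRight k a₁).lTensor A ∘ₗ (H.T₄.toLinearMap ∘ₗ TensorProduct.mk k A A c) =
      (LinearMap.mulLeft k c).lTensor A ∘ₗ
        (H.T₁.toLinearMap ∘ₗ (TensorProduct.mk k A A).flip a₁) :=
    LinearMap.ext fun s => H.lTensor_mulRight_T₄ c s a₁
  rw [H.lTensor_mulRight_T₄, ← h, lTensor_rTensor_comm, lTensor_rTensor_comm, lTensor_assoc_symm,
    lTensor_assoc_symm, ← LinearMap.lTensor_comp_apply V _ (H.T₄.toLinearMap ∘ₗ _), key,
    LinearMap.lTensor_comp_apply]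

/-- In a comodule coalgebra that is also a partial one, `(ι_A ⊗ ε_Y)T(y ⊗ a) = ε_Y(y) a`. -/
theorem sliceRight_counit_of_coassoc [Nontrivial A] [Nontrivial Y]
    (hT : IsT ρ T) (hε : ∀ y a, sliceLeft HA.counit Y (T (y ⊗ₜ a)) = HA.counit a • y)
    (hc : CoverCondition HY T) (hco : PartialCoassoc HA HY T)
    (h₁ : ∀ y a a₁ y₁, (LinearMap.mulRight k y₁).lTensor _ (iterT T y (HA.T₁ (a ⊗ₜ a₁))) =
      (HA.T₁.toLinearMap ∘ₗ (TensorProduct.mk k A A).flip a₁).rTensor Y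
        ((LinearMap.mulRight k y₁).lTensor A (T (y ⊗ₜ a)))) (y : Y) (x : A) :
    sliceRight A HY.counit (T (y ⊗ₜ x)) = HY.counit y • x := by
  obtain ⟨S, Φ, hS, hΦ, hΦT₄⟩ := HA.exists_antipode
  obtain ⟨c, rfl⟩ := hS x
  obtain ⟨a, ha⟩ := HA.exists_counit_eq_one
  obtain ⟨y₁, hy₁⟩ := HY.exists_counit_eq_one
  obtain ⟨z, hz⟩ := (hc y a y₁).1
  set θ : Y ⊗[k] A →ₗ[k] A := sliceRight A HY.counit ∘ₗ T with hθ
  set z' := (sliceRight A HY.counit).lTensor Y z with hz'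
  have hθmul : ∀ y a a', θ (y ⊗ₜ (a * a')) = θ (y ⊗ₜ a) * a' := fun y a a' => by
    rw [hθ, LinearMap.comp_apply, LinearMap.comp_apply,
      hT.tmul_mul (HA.nondegenerate.tensorProduct HY.nondegenerate), sliceRight_rTensor]
    rfl
  -- Partial and global coassociativity have the same left side. Applying ε_Y to the last leg of the
  -- two right sides removes the cover, as ε_Y(y₁) = 1.
  have eT₁ : ∀ a₁, θ.rTensor A ((TensorProduct.assoc k Y A A).symm
      ((HA.T₁.toLinearMap ∘ₗ (TensorProduct.mk k A A).flip a₁).lTensor Y z')) =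
      HA.T₁ (θ (y ⊗ₜ a) ⊗ₜ a₁) := by
    intro a₁
    rw [hz', hθ, ← sliceRight_coassocRight, ← hco.iterT_eq a₁ hz, h₁]
    rw [sliceRight_assoc, sliceRight_rTensor, sliceRight_lTensor_mulRight HY.counit_mul, hy₁, one_smul]
    rfl
  have eT₄ : θ.rTensor A ((TensorProduct.assoc k Y A A).symm
      ((HA.T₄.toLinearMap ∘ₗ TensorProduct.mk k A A c).lTensor Y z')) =
      HA.T₄ (c ⊗ₜ θ (y ⊗ₜ a)) :=
    HA.rTensor_T₄_eq eT₁ c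
  -- Right A-linearity of θ: θ(t ⊗ p)S(q) = θ(t ⊗ pS(q)).
  have keyΦ : ∀ u : Y ⊗[k] (A ⊗[k] A), Φ (θ.rTensor A ((TensorProduct.assoc k Y A A).symm u)) =
      θ (Φ.lTensor Y u) := by
    intro u
    induction u using TensorProduct.induction_on with
    | zero => simp
    | add x y hx hy => simp only [map_add, hx, hy]
    | tmul t w =>
    induction w using TensorProduct.induction_on with
    | zero => simp
    | add x y hx hy => simp only [map_add, TensorProduct.tmul_add, hx, hy]
    | tmul p q => simp [hΦ, hθmul]
  have h := congrArg Φ eT₄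
  rw [keyΦ, hΦT₄] at h
  -- The order of the two slices of T(y ⊗ a) is irrelevant, and slicing with ε_A first gives ε_A(a)y
  -- = y.
  have hε' : HA.counit (θ (y ⊗ₜ a)) = HY.counit y := by
    rw [hθ, LinearMap.comp_apply, ← counit_sliceLeft, hε, ha, one_smul]
  have keyz : ∀ z : Y ⊗[k] (A ⊗[k] Y), Φ.lTensor Y ((HA.T₄.toLinearMap ∘ₗ
      TensorProduct.mk k A A c).lTensor Y ((sliceRight A HY.counit).lTensor Y z)) =
        sliceRight Y (HY.counit ∘ₗ sliceLeft HA.counit Y) z ⊗ₜ S c := by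
    intro z
    induction z using TensorProduct.induction_on with
    | zero => simp
    | add x y hx hy => simp only [map_add, TensorProduct.add_tmul, hx, hy]
    | tmul r w => simp [hΦT₄, counit_sliceLeft, TensorProduct.smul_tmul']
  rw [hz', keyz, hz.sliceRight_counit hε, ha, hy₁, mul_one, one_smul, hε'] at h
  exact h

end Characterization

end MHopf

end

/-! ### The proposition. -/

theorem mainTheorem5 {k : Type*} [Field k]
    {A : Type*} [NonUnitalRing A] [Module k A] [SMulCommClass k A A] [IsScalarTower k A A]
    [Nontrivial A]
    {Y : Type*} [NonUnitalRing Y] [Module k Y] [SMulCommClass k Y Y] [IsScalarTower k Y Y]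
    (HA : MHopf.RegularMultiplierHopf k A) (HY : MHopf.RegularMultiplierHopf k Y)
    (ρ : Y →ₗ[k] MHopf.Multiplier k (A ⊗[k] Y))
    (hρ : MHopf.IsSymmetricPartialComoduleCoalgebra HA HY ρ) :
    MHopf.IsComoduleCoalgebra HA HY ρ ↔ ∀ y : Y, MHopf.CounitCondition HY ρ y := by
  obtain ⟨⟨T, hP⟩, Tb, hTb, hbar, hu⟩ := hρ
  have hA := HA.nondegenerate
  have hY := HY.nondegenerate
  have hAY := hA.tensorProduct (k := k) hY
  have hT := hP.isT
  rcases subsingleton_or_nontrivial Y with hsub | hnon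
  -- For Y = 0 no element has counit 1, but both sides of the equivalence hold trivially.
  · have : Subsingleton (A ⊗[k] Y) := (TensorProduct.comm k A Y).injective.subsingleton
    have : Subsingleton ((A ⊗[k] A) ⊗[k] Y) :=
      (TensorProduct.comm k (A ⊗[k] A) Y).injective.subsingleton
    have : Subsingleton (MHopf.Multiplier k ((A ⊗[k] A) ⊗[k] Y)) :=
      ⟨fun m n => MHopf.Multiplier.ext_of_L_R (fun _ => Subsingleton.elim _ _)
        fun _ => Subsingleton.elim _ _⟩
    refine iff_of_true ⟨⟨Function.injective_of_subsingleton _, T, Tb, hT, hTb, fun y =>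
      ⟨0, fun a b => ⟨Subsingleton.elim _ _, Subsingleton.elim _ _⟩,
        fun b => ⟨Subsingleton.elim _ _, Subsingleton.elim _ _⟩⟩⟩, T, hT, hP.cover, hP.comul⟩
      fun y b => ?_
    simp [Subsingleton.elim b 0]
  constructor
  · rintro ⟨⟨-, T', Tb', hT', hTb', hn⟩, -⟩ y
    obtain rfl := hT.unique hT' hAY
    rw [MHopf.counitCondition_iff hT hTb hA]
    refine MHopf.sliceRight_counit_of_coassoc hT
      (fun y a => hT.sliceLeft_counit hAY hY (hP.counit y) a) hP.cover hP.coassoc ?_ y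
    intro y a a₁ y₁
    obtain ⟨n, hn, hext⟩ := hn y
    -- Covering the global identity by 1 ⊗ a₁ ⊗ 1 replaces Δ_A by T₁ and brings everything into A ⊗
    -- A ⊗ Y.
    have h := congrArg (· * MHopf.midMult Y a₁) (hext (a ⊗ₜ y₁)).1
    simp only [mul_assoc] at h
    have hAAY := (hA.tensorProduct (k := k) hA).tensorProduct (k := k) hY
    rw [MHopf.comulTensorId_mul_midMult, MHopf.comulTensorId_mul_midMult, MHopf.mul_toMult hAAY,
      hT.L_tmul hAY] at h
    rw [← hn.L_tmul hA hY]
    exact MHopf.toMult_injective (k := k) hAAY h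
  · intro h
    have hθ : ∀ y a, MHopf.sliceRight A HY.counit (T (y ⊗ₜ a)) = HY.counit y • a := fun y =>
      (MHopf.counitCondition_iff hT hTb hA y).1 (h y)
    refine ⟨⟨MHopf.injective_of_counit hY hP.counit, T, Tb, hT, hTb, fun y => ?_⟩,
      T, hT, hP.cover, hP.comul⟩
    obtain ⟨n, hn, hL, hR⟩ := MHopf.exists_isIteratedCoaction hA hY hT hTb y
    refine ⟨n, hn, MHopf.extendsTo_comulTensorId hT hTb hL hR (fun a a₁ y₁ => ?_)
      (fun a a₁ => hbar.iterTbar_eq hu (fun a y => hTb.sliceRight_counit hT hA (hθ y) a) a a₁ y)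
      hY⟩
    obtain ⟨z, hz⟩ := (hP.cover y a y₁).1
    apply (TensorProduct.assoc k A A Y).injective
    rw [hP.coassoc.iterT_eq a₁ hz, MHopf.coassocRight_of_counit hθ, hz.sliceLeft_counit]
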